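/- Let $g\ge 1$ and let $\Sigma_g$ be the closed oriented surface of genus $g$. A brane tiling $\Delta$ of $\Sigma_g$ is a finite bipartite graph (multiple edges allowed), with vertices coloured black and white, embedded in $\Sigma_g$ so that every connected component (tile) of the complement is simply connected (equivalently, is an open polygon). Its dual quiver $Q_\Delta$ has the $r$ tiles as vertices and one arrow for each edge, joining the two tiles adjacent to the edge, oriented so that the arrows dual to the edges at a black vertex $v$ form a clockwise cycle $c_v$ and those dual to the edges at a white vertex $v$ form a counterclockwise cycle $c_v$. Put $W_\Delta=\sum_{v\text{ white}}c_v-\sum_{v\text{ black}}c_v$. Assume that $\Delta$ can be graded, i.e. that there is a function $d$ from the arrows of $Q_\Delta$ to $\mathbb{Q}$ for which $W_\Delta$ is homogeneous of weight $1$ (each $c_v$ has total weight $1$). Let $\widetilde{\mathbb{C}Q_\Delta}$ be the localized path algebra, obtained from $\mathbb{C}Q_\Delta$ by adjoining for each arrow $a$ an arrow $a^*$ in the opposite direction, subject to $a^*a=e_{s(a)}$ and $aa^*=e_{t(a)}$, and let $\mathrm{Jac}(\widetilde{\mathbb{C}Q_\Delta},W_\Delta)$ be its quotient by the two-sided ideal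 generated by the cyclic derivatives $\partial W_\Delta/\partial a$, for all arrows $a$ of $Q_\Delta$, where $\partial u/\partial a=\sum_{u=vaw}wv$ for a cyclic path $u$. Then there is an isomorphism of $\mathbb{C}$-algebras $$\mathrm{Jac}(\widetilde{\mathbb{C}Q_\Delta},W_\Delta)\;\cong\;\mathrm{Mat}_{r\times r}\big(\mathbb{C}[\pi_1(\Sigma_g\times S^1)]\big).$$ No consistency hypothesis on $\Delta$ is needed. -/

import Mathlib

noncomputable section

/-! ### Path algebras, localized path algebras and Jacobi algebras -/

/-- A path of a quiver, together with its source `p.1` and its target `p.2.1`. -/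
abbrev TotalPath (V : Type*) [Quiver V] := Σ i j : V, Quiver.Path i j

/-- The path algebra of a quiver: the free module on the set of all paths. -/
def PathAlgebra (k V : Type*) [CommRing k] [Quiver V] := TotalPath V →₀ k

namespace PathAlgebra

variable (k : Type*) [CommRing k] {V : Type*} [Quiver V]

instance : AddCommGroup (PathAlgebra k V) := inferInstanceAs (AddCommGroup (TotalPath V →₀ k))
instance : Module k (PathAlgebra k V) := inferInstanceAs (Module k (TotalPath V →₀ k))

/-- The basis element of the path algebra given by a path. -/
def of (p : TotalPath V) : PathAlgebra k V := Finsupp.single p 1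

/-- The basis element of the path algebra given by a path with specified endpoints. -/
def path {i j : V} (p : Quiver.Path i j) : PathAlgebra k V := of k ⟨i, j, p⟩

/-- The idempotent `e_i`, i.e. the path of length zero at `i`. -/
def vertex (i : V) : PathAlgebra k V := path k (Quiver.Path.nil : Quiver.Path i i)

/-- An arrow as an element of the path algebra. -/
def arrow {i j : V} (a : i ⟶ j) : PathAlgebra k V := path k a.toPath

variable {k} in
/-- The linear map out of the path algebra with prescribed values on paths. -/
def lift {M : Type*} [AddCommGroup M] [Module k M] (f : TotalPath V → M) :
    PathAlgebra k V →ₗ[k] M :=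
  Finsupp.linearCombination k f

@[simp] theorem lift_of {M : Type*} [AddCommGroup M] [Module k M] (f : TotalPath V → M)
    (p : TotalPath V) : lift f (of k p) = f p :=
  (Finsupp.linearCombination_single k 1 p).trans (one_smul k _)

theorem hom_ext {M : Type*} [AddCommGroup M] [Module k M] {f g : PathAlgebra k V →ₗ[k] M}
    (h : ∀ p, f (of k p) = g (of k p)) : f = g :=
  Finsupp.lhom_ext' fun p => LinearMap.ext_ring (h p)

open Classical in
/-- The product of two paths: `p * q` is the path "first `q`, then `p`" if the target of `q` is the
source of `p`, and zero otherwise. -/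
def mulPath (p q : TotalPath V) : PathAlgebra k V :=
  if h : q.2.1 = p.1 then path k (q.2.2.comp (p.2.2.cast h.symm rfl)) else 0

/-- Multiplication in the path algebra as a bilinear map. -/
def mulMap : PathAlgebra k V →ₗ[k] PathAlgebra k V →ₗ[k] PathAlgebra k V :=
  lift fun p => lift fun q => mulPath k p q

instance : Mul (PathAlgebra k V) := ⟨fun x y => mulMap k x y⟩
instance [Fintype V] : One (PathAlgebra k V) := ⟨∑ i : V, vertex k i⟩

theorem mul_eq (x y : PathAlgebra k V) : x * y = mulMap k x y := rfl

theorem one_eq [Fintype V] : (1 : PathAlgebra k V) = ∑ i : V, vertex k i := rfl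

@[simp] theorem mulMap_of (p q : TotalPath V) : mulMap k (of k p) (of k q) = mulPath k p q := by
  simp [mulMap]

theorem mulMap_path {i j l : V} (p : Quiver.Path j l) (q : Quiver.Path i j) :
    mulMap k (path k p) (path k q) = path k (q.comp p) := by
  simp [path, mulPath]

theorem mulMap_path_of_ne {i j j' l : V} (p : Quiver.Path j' l) (q : Quiver.Path i j)
    (h : j ≠ j') : mulMap k (path k p) (path k q) = 0 := by
  simp [path, mulPath, h]

theorem mulMap_assoc (x y z : PathAlgebra k V) :
    mulMap k (mulMap k x y) z = mulMap k x (mulMap k y z) := by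
  let L : PathAlgebra k V →ₗ[k] PathAlgebra k V →ₗ[k] PathAlgebra k V →ₗ[k] PathAlgebra k V :=
    (mulMap k).compr₂ (mulMap k)
  let R : PathAlgebra k V →ₗ[k] PathAlgebra k V →ₗ[k] PathAlgebra k V →ₗ[k] PathAlgebra k V :=
    ((LinearMap.llcomp k (PathAlgebra k V) (PathAlgebra k V) (PathAlgebra k V)).compl₂
      (mulMap k)).comp (mulMap k)
  have hLR : L = R := by
    refine hom_ext k fun p => hom_ext k fun q => hom_ext k fun r => ?_
    obtain ⟨p₁, p₂, p⟩ := p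
    obtain ⟨q₁, q₂, q⟩ := q
    obtain ⟨r₁, r₂, r⟩ := r
    change mulMap k (mulMap k (path k p) (path k q)) (path k r) =
      mulMap k (path k p) (mulMap k (path k q) (path k r))
    by_cases h₁ : q₂ = p₁
    · subst h₁
      rw [mulMap_path]
      by_cases h₂ : r₂ = q₁
      · subst h₂
        simp only [mulMap_path, Quiver.Path.comp_assoc]
      · rw [mulMap_path_of_ne k _ _ h₂, mulMap_path_of_ne k _ _ h₂, map_zero]
    · rw [mulMap_path_of_ne k _ _ h₁, map_zero, LinearMap.zero_apply]
      by_cases h₂ : r₂ = q₁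
      · subst h₂
        rw [mulMap_path, mulMap_path_of_ne k _ _ h₁]
      · rw [mulMap_path_of_ne k _ _ h₂, map_zero]
  exact congrArg (fun F => F x y z) hLR

theorem one_mulMap [Fintype V] (x : PathAlgebra k V) : mulMap k 1 x = x := by
  classical
  have h : mulMap k (1 : PathAlgebra k V) = LinearMap.id := by
    refine hom_ext k fun ⟨i, j, p⟩ => ?_
    change mulMap k 1 (path k p) = path k p
    rw [one_eq, map_sum, LinearMap.sum_apply, Finset.sum_eq_single j]
    · rw [vertex, mulMap_path, Quiver.Path.comp_nil]
    · intro l _ hl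
      exact mulMap_path_of_ne k _ _ hl.symm
    · simp
  rw [h, LinearMap.id_apply]

theorem mulMap_one [Fintype V] (x : PathAlgebra k V) : mulMap k x 1 = x := by
  classical
  have h : (mulMap k).flip (1 : PathAlgebra k V) = LinearMap.id := by
    refine hom_ext k fun ⟨i, j, p⟩ => ?_
    change mulMap k (path k p) 1 = path k p
    rw [one_eq, map_sum, Finset.sum_eq_single i]
    · rw [vertex, mulMap_path, Quiver.Path.nil_comp]
    · intro l _ hl
      exact mulMap_path_of_ne k _ _ hl
    · simp
  exact congrArg (fun F => F x) h

instance [Fintype V] : Ring (PathAlgebra k V) where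
  __ := (inferInstance : AddCommGroup (PathAlgebra k V))
  left_distrib x y z := map_add (mulMap k x) y z
  right_distrib x y z := by simp only [mul_eq, map_add, LinearMap.add_apply]
  zero_mul x := by simp only [mul_eq, map_zero, LinearMap.zero_apply]
  mul_zero x := map_zero (mulMap k x)
  mul_assoc := mulMap_assoc k
  one_mul := one_mulMap k
  mul_one := mulMap_one k

instance [Fintype V] : Algebra k (PathAlgebra k V) :=
  Algebra.ofModule (fun r x y => by simp only [mul_eq, map_smul, LinearMap.smul_apply])
    (fun r x y => map_smul (mulMap k x) r y)

/-- The decompositions of a path `u` as "first `w`, then `a`, then `v`" are finite in number, so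
that the sum in `cyclicDerivative` is a genuine finite sum. -/
theorem finite_decompositions {i j s t : V} (a : i ⟶ j) (u : Quiver.Path s t) :
    Finite {d : Quiver.Path s i × Quiver.Path j t // (d.1.cons a).comp d.2 = u} := by
  refine Finite.of_injective
    (fun d => (⟨d.1.1.length, ?_⟩ : Fin (u.length + 1))) ?_
  · have h := congrArg Quiver.Path.length d.2
    simp only [Quiver.Path.length_comp, Quiver.Path.length_cons] at h
    omega
  · rintro ⟨⟨w, v⟩, h⟩ ⟨⟨w', v'⟩, h'⟩ hl
    have hl' : w.length = w'.length := congrArg Fin.val hl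
    obtain ⟨h₁, h₂⟩ := (Quiver.Path.comp_inj' (by simp [hl'])).1 (h.trans h'.symm)
    simp only [Quiver.Path.cons.injEq, heq_eq_eq, true_and, and_true] at h₁
    subst h₁ h₂
    rfl

variable {k} in
/-- The cyclic derivative `∂/∂a`: the linear map sending a closed path `u` to the sum of `w v` over
all decompositions `u = v a w` (that is, first `w`, then `a`, then `v`). If `u` is not closed then
all the products `w v` vanish. It depends only on the class modulo commutators. -/
def cyclicDerivative {i j : V} (a : i ⟶ j) : PathAlgebra k V →ₗ[k] PathAlgebra k V :=
  lift fun u => ∑ᶠ d : {d : Quiver.Path u.1 i × Quiver.Path j u.2.1 //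
    (d.1.cons a).comp d.2 = u.2.2}, path k d.1.1 * path k d.1.2

end PathAlgebra

instance {V : Type*} [Fintype V] : Fintype (Quiver.Symmetrify V) := inferInstanceAs (Fintype V)

section Jacobi

variable (k : Type*) [CommRing k] (V : Type*) [Quiver V] [Fintype V]

/-- The relations `a* a = e_{s(a)}` and `a a* = e_{t(a)}`, for all arrows `a` of a quiver, in the
path algebra of the quiver obtained by adding an arrow `a*` in the opposite direction for every
arrow `a`. -/
inductive LocalizationRel :
    PathAlgebra k (Quiver.Symmetrify V) → PathAlgebra k (Quiver.Symmetrify V) → Prop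
  | star_mul {i j : V} (a : i ⟶ j) : LocalizationRel
      (PathAlgebra.arrow k (Quiver.Hom.toNeg a) * PathAlgebra.arrow k (Quiver.Hom.toPos a))
      (PathAlgebra.vertex k (V := Quiver.Symmetrify V) i)
  | mul_star {i j : V} (a : i ⟶ j) : LocalizationRel
      (PathAlgebra.arrow k (Quiver.Hom.toPos a) * PathAlgebra.arrow k (Quiver.Hom.toNeg a))
      (PathAlgebra.vertex k (V := Quiver.Symmetrify V) j)

/-- The path algebra localized at all arrows of the quiver. -/
abbrev LocalizedPathAlgebra := RingQuot (LocalizationRel k V)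

/-- The natural map from the path algebra to the localized path algebra. -/
def PathAlgebra.toLocalized : PathAlgebra k V →ₗ[k] LocalizedPathAlgebra k V :=
  PathAlgebra.lift fun p => RingQuot.mkAlgHom k (LocalizationRel k V)
    (PathAlgebra.path k (Quiver.Symmetrify.of.mapPath p.2.2))

variable {k V}

/-- The relations `∂W/∂a = 0`, for all arrows `a`, in the localized path algebra. -/
inductive JacobiRel (W : PathAlgebra k V) :
    LocalizedPathAlgebra k V → LocalizedPathAlgebra k V → Prop
  | intro {i j : V} (a : i ⟶ j) :
      JacobiRel W (PathAlgebra.toLocalized k V (PathAlgebra.cyclicDerivative a W)) 0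

/-- The localized Jacobi algebra of a quiver with potential, all arrows being inverted. -/
abbrev LocalizedJacobiAlgebra (W : PathAlgebra k V) := RingQuot (JacobiRel W)

end Jacobi

/-! ### Surfaces -/

/-- The boundary point `exp (2πi s / 4g)` of the closed unit disc, regarded as a `4g`-gon whose
sides are the arcs `m ≤ s ≤ m + 1`. -/
def polygonPoint (g : ℕ) (s : ℝ) : Metric.closedBall (0 : ℂ) 1 :=
  ⟨Circle.exp (2 * Real.pi * s / (4 * g)), by
    rw [mem_closedBall_zero_iff, Circle.norm_coe]⟩

/-- The side identifications of the `4g`-gon with boundary word `∏ a_i b_i a_i⁻¹ b_i⁻¹`. -/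
inductive SurfaceRel (g : ℕ) : Metric.closedBall (0 : ℂ) 1 → Metric.closedBall (0 : ℂ) 1 → Prop
  | a (m : Fin g) (t : unitInterval) :
      SurfaceRel g (polygonPoint g (4 * m + t)) (polygonPoint g (4 * m + 3 - t))
  | b (m : Fin g) (t : unitInterval) :
      SurfaceRel g (polygonPoint g (4 * m + 1 + t)) (polygonPoint g (4 * m + 4 - t))

/-- The closed orientable surface `Σ_g` of genus `g ≥ 1`, with the quotient topology. -/
abbrev ClosedSurface (g : ℕ) := Quot (SurfaceRel g)

/-! ### Brane tilings -/

/-- The combinatorial data of a finite bipartite graph (multiple edges allowed) in an oriented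
surface: `σ` sends an edge to the next edge in counterclockwise order around its white endpoint, and
`τ` sends it to the next edge in counterclockwise order around its black endpoint. -/
structure BipartiteRotationSystem where
  /-- The edges. -/
  Edge : Type
  [fintypeEdge : Fintype Edge]
  /-- Counterclockwise rotation around the white vertices. -/
  σ : Equiv.Perm Edge
  /-- Counterclockwise rotation around the black vertices. -/
  τ : Equiv.Perm Edge

namespace BipartiteRotationSystem

attribute [instance] fintypeEdge

variable (Δ : BipartiteRotationSystem)

/-- The white vertices: the cycles of `σ`. -/
def White := Quotient (Equiv.Perm.SameCycle.setoid Δ.σ)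

/-- The black vertices: the cycles of `τ`. -/
def Black := Quotient (Equiv.Perm.SameCycle.setoid Δ.τ)

/-- The tiles: the cycles of `τ ∘ σ`. The cycle of `e` is the tile to the left of `e`, when `e` is
directed from white to black; going around this tile, the next edge that has it on its left is
`τ (σ e)`. -/
def Tile := Quotient (Equiv.Perm.SameCycle.setoid (Δ.τ * Δ.σ))

instance : Finite Δ.White := inferInstanceAs (Finite (Quotient _))
instance : Finite Δ.Black := inferInstanceAs (Finite (Quotient _))
instance : Finite Δ.Tile := inferInstanceAs (Finite (Quotient _))
instance : Fintype Δ.White := Fintype.ofFinite _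
instance : Fintype Δ.Black := Fintype.ofFinite _
instance : Fintype Δ.Tile := Fintype.ofFinite _

variable {Δ}

/-- The white endpoint of an edge. -/
def white (e : Δ.Edge) : Δ.White := Quotient.mk _ e

/-- The black endpoint of an edge. -/
def black (e : Δ.Edge) : Δ.Black := Quotient.mk _ e

/-- The tile to the left of an edge directed from white to black. -/
def leftTile (e : Δ.Edge) : Δ.Tile := Quotient.mk _ e

/-- The tile to the right of an edge `e` directed from white to black; it is to the left of the
edge that follows `e` counterclockwise around the black endpoint. -/
def rightTile (e : Δ.Edge) : Δ.Tile := leftTile (Δ.τ e)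

theorem leftTile_eq_rightTile_σ (e : Δ.Edge) : leftTile e = rightTile (Δ.σ e) :=
  Quotient.sound ⟨1, by simp⟩

theorem leftTile_eq_rightTile_τ_symm (e : Δ.Edge) : leftTile e = rightTile (Δ.τ.symm e) := by
  simp [rightTile]

variable (Δ)

/-- The gluing of the unit squares `e × [0,1]²`. In the square of the edge `e`, the corner `(0,0)` is
the white endpoint of `e`, the corner `(1,1)` is its black endpoint, the diagonal is `e` itself, and
`(0,1)` and `(1,0)` are the centres of the tiles to the left and to the right of `e`. -/
inductive GluingRel : (Σ _ : Δ.Edge, unitInterval × unitInterval) → (Σ _ : Δ.Edge, unitInterval × unitInterval) → Prop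
  | white (e : Δ.Edge) (t : unitInterval) : GluingRel ⟨e, (0, t)⟩ ⟨Δ.σ e, (t, 0)⟩
  | black (e : Δ.Edge) (t : unitInterval) : GluingRel ⟨e, (1, t)⟩ ⟨Δ.τ e, (t, 1)⟩

/-- The surface obtained by gluing polygonal tiles along the edges of the graph: each tile is the
union of the triangles joining its centre to its sides, and the two triangles on either side of an
edge `e` form the unit square of `e`. The graph is the union of the diagonals of the squares, and
every component of its complement is an open polygon. -/
abbrev Realization := Quot Δ.GluingRel

/-- The quiver dual to the graph: the vertices are the tiles, and the arrow dual to `e` crosses `e`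
from right to left (when `e` is directed from white to black), that is, clockwise around the black
endpoint and counterclockwise around the white endpoint. -/
instance : Quiver Δ.Tile where
  Hom i j := {e : Δ.Edge // rightTile e = i ∧ leftTile e = j}

variable {Δ}

/-- The arrow dual to an edge. -/
def dualArrow (e : Δ.Edge) : rightTile e ⟶ leftTile e := ⟨e, rfl, rfl⟩

/-- The path `a_e, a_{ρ e}, …, a_{ρ^(n-1) e}` in the dual quiver, where `a_e` is the arrow dual to
`e`, for a permutation `ρ` for which these arrows are consecutive. -/
def walk (ρ : Equiv.Perm Δ.Edge) (hρ : ∀ e, leftTile e = rightTile (ρ e)) (e : Δ.Edge) :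
    (n : ℕ) → Quiver.Path (rightTile e) (rightTile ((ρ ^ n) e))
  | 0 => Quiver.Path.nil
  | n + 1 => (walk ρ hρ e n).cons
      ⟨(ρ ^ n) e, rfl, by rw [hρ, ← Equiv.Perm.mul_apply, ← pow_succ']⟩

/-- The minimal cycle around the white endpoint of `e` (counterclockwise), starting with the arrow
dual to `e`. -/
def whiteCycle (e : Δ.Edge) : TotalPath Δ.Tile :=
  ⟨_, _, walk Δ.σ leftTile_eq_rightTile_σ e (Function.minimalPeriod Δ.σ e)⟩

/-- The minimal cycle around the black endpoint of `e` (clockwise), starting with the arrow dual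
to `e`. -/
def blackCycle (e : Δ.Edge) : TotalPath Δ.Tile :=
  ⟨_, _, walk Δ.τ.symm leftTile_eq_rightTile_τ_symm e (Function.minimalPeriod Δ.τ.symm e)⟩

variable (Δ)

/-- (A lift to the path algebra of) the potential: the sum of the minimal cycles around the white
vertices minus the sum of the minimal cycles around the black vertices. The choice of an edge at
each vertex at which its cycle starts does not matter modulo commutators. -/
def potential : PathAlgebra ℂ Δ.Tile :=
  ∑ v : Δ.White, PathAlgebra.of ℂ (whiteCycle (Quotient.out v)) -
    ∑ v : Δ.Black, PathAlgebra.of ℂ (blackCycle (Quotient.out v))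

open Classical in
/-- The arrows of the dual quiver (i.e. the edges) can be graded by rational numbers in such a way
that the potential is homogeneous of weight one, i.e. such that the minimal cycle around each vertex
has total weight one. -/
def IsGraded : Prop :=
  ∃ d : Δ.Edge → ℚ, (∀ v : Δ.White, ∑ e with white e = v, d e = 1) ∧
    (∀ v : Δ.Black, ∑ e with black e = v, d e = 1)

end BipartiteRotationSystem

/-- A brane tiling of a surface `S`: a finite bipartite graph embedded in `S` with coloured vertices
and polygonal tiles, given by its rotation system together with an identification of `S` with the
surface obtained by gluing the tiles. -/
structure BraneTiling (S : Type*) [TopologicalSpace S] extends BipartiteRotationSystem where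
  /-- The surface is the union of the tiles. -/
  homeo : toBipartiteRotationSystem.Realization ≃ₜ S

end

/-! Once all arrows are inverted, multiplying `∂W/∂a` by `a` turns the relation into an equality of
two closed paths: the cycle around the white end of an edge equals the cycle around its black end.
The localized Jacobi algebra is therefore the algebra of a connected groupoid, hence a matrix
algebra over the group algebra of a vertex group. After the choice of a path `p i` from a base tile
to every tile, this group is `VertexGroup p`: its generators are the edges, the two cycles at every
edge are identified, and the paths `p i` are killed. `nonempty_algEquiv` carries this out. The
products `p i * (p j)⁻¹` are matrix units, every edge gives a unit commuting with them, and each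
path is such a unit times a matrix unit (`pathMk_eq`).

In the vertex group all cycles equal one central element `c` (`exists_central_cycleProd`), and
killing `c` leaves `SurfaceGroup p`. Only here does the grading enter. A rational grading forces
equal numbers of white and black vertices, which on a connected graph suffices for an integral
grading (`IsGraded.exists_integral`). An integral grading is a homomorphism to `ℤ` that takes the
value 1 on `c`, so it splits the central extension, and `VertexGroup p` is `SurfaceGroup p × ℤ`
(`IsGraded.nonempty_mulEquiv`). The factor `ℤ` is the fundamental group of the circle.

It remains to identify `SurfaceGroup p` with the fundamental group of the glued surface. An edge is
sent to the loop that crosses it (`loopHom`). Surjectivity: the stars of the white vertices, of the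
black vertices and of the tile centres form an open cover, and each star contracts to its centre, so
a subdivided loop becomes a product of crossings (`closure_loop_eq_top`). Injectivity: copies of the
squares indexed by `SurfaceGroup p` are glued to a covering space, which is unbranched over the
vertices precisely because the cycles are trivial (`Cover.isQuotientCoveringMap_proj`); its
monodromy recovers the group element (`loopHom_injective`). No presentation read off from the
`4g`-gon is needed. -/

noncomputable section

/-! ### Products of group elements along walks -/

/-- The product `φ (ρ^(n-1) e) * ⋯ * φ (ρ e) * φ e`. -/
def walkProd {α M : Type*} [Monoid M] (φ : α → M) (ρ : Equiv.Perm α) (e : α) : ℕ → M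
  | 0 => 1
  | n + 1 => φ ((ρ ^ n) e) * walkProd φ ρ e n

/-- The product of the values of `φ` along the cycle of `ρ` that starts at `e`. -/
def cycleProd {α M : Type*} [Monoid M] (φ : α → M) (ρ : Equiv.Perm α) (e : α) : M :=
  walkProd φ ρ e (Function.minimalPeriod ρ e)

section walkProd

variable {α M N K : Type*} [Monoid M] [Monoid N] [Group K]

theorem map_walkProd (f : M →* N) (φ : α → M) (ρ : Equiv.Perm α) (e : α) (n : ℕ) :
    f (walkProd φ ρ e n) = walkProd (fun x => f (φ x)) ρ e n := by
  induction n with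
  | zero => simp [walkProd]
  | succ n ih => simp [walkProd, ih]

theorem map_cycleProd (f : M →* N) (φ : α → M) (ρ : Equiv.Perm α) (e : α) :
    f (cycleProd φ ρ e) = cycleProd (fun x => f (φ x)) ρ e :=
  map_walkProd f φ ρ e _

theorem walkProd_add (φ : α → M) (ρ : Equiv.Perm α) (e : α) (m n : ℕ) :
    walkProd φ ρ e (m + n) = walkProd φ ρ ((ρ ^ m) e) n * walkProd φ ρ e m := by
  induction n with
  | zero => simp [walkProd]
  | succ n ih =>
    rw [← add_assoc, walkProd, ih, walkProd, mul_assoc, ← Equiv.Perm.mul_apply, ← pow_add,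
      add_comm n m]

theorem walkProd_succ' (φ : α → M) (ρ : Equiv.Perm α) (e : α) (n : ℕ) :
    walkProd φ ρ e (n + 1) = walkProd φ ρ (ρ e) n * φ e := by
  rw [add_comm, walkProd_add]
  simp [walkProd]

theorem walkProd_mul {φ ψ : α → M} (h : ∀ e e', Commute (φ e) (ψ e')) (ρ : Equiv.Perm α) (e : α)
    (n : ℕ) : walkProd (fun x => φ x * ψ x) ρ e n = walkProd φ ρ e n * walkProd ψ ρ e n := by
  have hc : ∀ e', ∀ m, Commute (walkProd φ ρ e m) (ψ e') := by
    intro e' m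
    induction m with
    | zero => exact Commute.one_left _
    | succ m ih => exact (h _ _).mul_left ih
  induction n with
  | zero => simp [walkProd]
  | succ n ih =>
    simp only [walkProd, ih]
    rw [mul_assoc, mul_assoc, ← mul_assoc (ψ _), ← (hc _ n).eq, mul_assoc]

theorem pow_minimalPeriod_apply (ρ : Equiv.Perm α) (e : α) :
    (ρ ^ Function.minimalPeriod ρ e) e = e := by
  rw [Equiv.Perm.coe_pow]
  exact Function.isPeriodicPt_minimalPeriod ρ e

theorem minimalPeriod_apply_perm (ρ : Equiv.Perm α) (e : α) :
    Function.minimalPeriod ρ (ρ e) = Function.minimalPeriod ρ e := by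
  refine Nat.dvd_antisymm ?_ ?_ <;> rw [← Function.isPeriodicPt_iff_minimalPeriod_dvd]
  · exact (Function.isPeriodicPt_minimalPeriod ρ e).apply
  · have h := Function.isPeriodicPt_minimalPeriod ρ (ρ e)
    refine ρ.injective ?_
    exact (Function.iterate_succ_apply' ρ _ e).symm.trans h

/-- Both sides are the product along the walk from `e` that is one step longer than the period, with
either the first or the last factor split off. -/
theorem cycleProd_apply_mul (φ : α → M) (ρ : Equiv.Perm α) (e : α) :
    cycleProd φ ρ (ρ e) * φ e = φ e * cycleProd φ ρ e := by
  rw [cycleProd, minimalPeriod_apply_perm, ← walkProd_succ', walkProd, pow_minimalPeriod_apply]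
  rfl

theorem cycleProd_pow_mul (φ : α → M) (ρ : Equiv.Perm α) (e : α) (k : ℕ) :
    cycleProd φ ρ ((ρ ^ k) e) * walkProd φ ρ e k = walkProd φ ρ e k * cycleProd φ ρ e := by
  induction k with
  | zero => simp [walkProd]
  | succ k ih =>
    rw [walkProd, pow_succ', Equiv.Perm.mul_apply, ← mul_assoc, cycleProd_apply_mul, mul_assoc, ih,
      mul_assoc]

/-- The product along a cycle, with one factor removed and the others in cyclic order. -/
theorem walkProd_mul_walkProd (φ : α → K) (ρ : Equiv.Perm α) (e : α) {k m : ℕ}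
    (h : k + 1 + m = Function.minimalPeriod ρ e) :
    walkProd φ ρ e k * walkProd φ ρ ((ρ ^ (k + 1)) e) m =
      cycleProd φ ρ ((ρ ^ k) e) * (φ ((ρ ^ k) e))⁻¹ := by
  have h1 := cycleProd_pow_mul φ ρ e k
  have h2 : cycleProd φ ρ e = walkProd φ ρ ((ρ ^ (k + 1)) e) m * walkProd φ ρ e (k + 1) := by
    rw [cycleProd, ← h, walkProd_add]
  rw [h2, walkProd] at h1
  have h3 : cycleProd φ ρ ((ρ ^ k) e) =
      walkProd φ ρ e k * walkProd φ ρ ((ρ ^ (k + 1)) e) m * φ ((ρ ^ k) e) :=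
    mul_right_cancel (h1.trans (by simp only [mul_assoc]))
  rw [h3, mul_inv_cancel_right]

/-- The product telescopes: `u` is a primitive of `φ` along the cycles of `ρ`. -/
theorem walkProd_eq_of_potential {φ u : α → K} {ρ : Equiv.Perm α}
    (h : ∀ e, u (ρ e) = u e * (φ e)⁻¹) (e : α) (n : ℕ) :
    walkProd φ ρ e n = (u ((ρ ^ n) e))⁻¹ * u e := by
  induction n with
  | zero => simp [walkProd]
  | succ n ih =>
    rw [walkProd, ih, pow_succ', Equiv.Perm.mul_apply, h]
    group

theorem cycleProd_eq_one_of_potential {φ u : α → K} {ρ : Equiv.Perm α}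
    (h : ∀ e, u (ρ e) = u e * (φ e)⁻¹) (e : α) : cycleProd φ ρ e = 1 := by
  rw [cycleProd, walkProd_eq_of_potential h, pow_minimalPeriod_apply, inv_mul_cancel]

theorem walkProd_eq_one_of_fixed {φ : α → K} {ρ : Equiv.Perm α} (h : ∀ e, cycleProd φ ρ e = 1)
    {e : α} {n : ℕ} (hn : (ρ ^ n) e = e) : walkProd φ ρ e n = 1 := by
  have hp : Function.IsPeriodicPt ρ n e := by
    rw [Function.IsPeriodicPt, ← Equiv.Perm.coe_pow]
    exact hn
  obtain ⟨k, rfl⟩ := (Function.isPeriodicPt_iff_minimalPeriod_dvd).1 hp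
  clear hn hp
  induction k with
  | zero => simp [walkProd]
  | succ k ih =>
    rw [mul_add, mul_one, add_comm, walkProd_add, pow_minimalPeriod_apply, ih, one_mul]
    exact h e

theorem walkProd_congr {φ : α → K} {ρ : Equiv.Perm α} (h : ∀ e, cycleProd φ ρ e = 1)
    {e : α} {m n : ℕ} (hmn : (ρ ^ m) e = (ρ ^ n) e) : walkProd φ ρ e m = walkProd φ ρ e n := by
  wlog hle : m ≤ n generalizing m n
  · exact (this hmn.symm (le_of_not_ge hle)).symm
  obtain ⟨k, rfl⟩ := Nat.exists_eq_add_of_le hle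
  rw [walkProd_add, walkProd_eq_one_of_fixed h (n := k), one_mul]
  rw [← Equiv.Perm.mul_apply, ← pow_add, add_comm k m, ← hmn]

/-- On each cycle, `u e` is the inverse of the product from a chosen base edge to `e`. Triviality of
the full cycle makes this independent of the number of turns. Such a `u` later trivializes the
covering space over the star of a vertex. -/
theorem exists_potential [Finite α] {φ : α → K} {ρ : Equiv.Perm α}
    (h : ∀ e, cycleProd φ ρ e = 1) : ∃ u : α → K, ∀ e, u (ρ e) = u e * (φ e)⁻¹ := by
  classical
  let base : α → α := fun e => Quotient.out (Quotient.mk (Equiv.Perm.SameCycle.setoid ρ) e)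
  have hb : ∀ e, ρ.SameCycle (base e) e := fun e =>
    Quotient.mk_out (s := Equiv.Perm.SameCycle.setoid ρ) e
  have hbρ : ∀ e, base (ρ e) = base e := fun e =>
    congrArg Quotient.out (Quotient.sound ⟨-1, by simp⟩)
  choose n hn using fun e => (hb e).exists_pow_eq'
  refine ⟨fun e => (walkProd φ ρ (base e) (n e))⁻¹, fun e => ?_⟩
  rw [← mul_inv_rev, inv_inj, hbρ]
  have h1 : φ e * walkProd φ ρ (base e) (n e) = walkProd φ ρ (base e) (n e + 1) := by
    rw [walkProd, (hn e).2]
  rw [h1]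
  refine walkProd_congr h ?_
  have h2 := (hn (ρ e)).2
  rw [hbρ] at h2
  rw [pow_succ', Equiv.Perm.mul_apply, (hn e).2, h2]

theorem eq_of_sameCycle {β : Type*} {ρ : Equiv.Perm α} {F : α → β} (hF : ∀ e, F (ρ e) = F e)
    {x y : α} (h : ρ.SameCycle x y) : F x = F y := by
  obtain ⟨n, rfl⟩ := h
  induction n using Int.induction_on with
  | zero => rfl
  | succ n ih => rw [ih, add_comm, zpow_add, Equiv.Perm.mul_apply, zpow_one, hF]
  | pred n ih =>
    rw [ih, ← hF ((ρ ^ (-(n : ℤ) - 1)) x), ← Equiv.Perm.mul_apply, ← zpow_one_add]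
    congr 2
    ring_nf

open Classical in
theorem cycleProd_ofAdd [Fintype α] (d : α → ℤ) (ρ : Equiv.Perm α) (e : α) :
    cycleProd (fun x => Multiplicative.ofAdd (d x)) ρ e =
      Multiplicative.ofAdd (∑ x with ρ.SameCycle x e, d x) := by
  have h1 : ∀ n, walkProd (fun x => Multiplicative.ofAdd (d x)) ρ e n =
      Multiplicative.ofAdd (∑ i ∈ Finset.range n, d ((ρ ^ i) e)) := by
    intro n
    induction n with
    | zero => simp [walkProd]
    | succ n ih => rw [walkProd, ih, Finset.sum_range_succ, ← ofAdd_add, add_comm]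
  rw [cycleProd, h1]
  congr 1
  refine Finset.sum_bij (fun i _ => (ρ ^ i) e) ?_ ?_ ?_ ?_
  · intro i _
    simp only [Finset.mem_filter, Finset.mem_univ, true_and]
    exact ⟨-(i : ℤ), by simp⟩
  · intro i hi j hj hij
    rw [Equiv.Perm.coe_pow, Equiv.Perm.coe_pow] at hij
    exact (Function.iterate_eq_iterate_iff_of_lt_minimalPeriod (Finset.mem_range.1 hi)
      (Finset.mem_range.1 hj)).1 hij
  · intro x hx
    simp only [Finset.mem_filter, Finset.mem_univ, true_and] at hx
    obtain ⟨n, hn, rfl⟩ := hx.symm.exists_pow_eq'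
    refine ⟨n % Function.minimalPeriod ρ e, Finset.mem_range.2 (Nat.mod_lt _ ?_), ?_⟩
    · exact Function.minimalPeriod_pos_of_mem_periodicPts
        (Function.Injective.mem_periodicPts ρ.injective e)
    · rw [Equiv.Perm.coe_pow, Equiv.Perm.coe_pow, Function.iterate_mod_minimalPeriod_eq]
  · simp

end walkProd

namespace BipartiteRotationSystem

variable {Δ : BipartiteRotationSystem}

/-- The product of the values of `φ` along a path of the dual quiver with inverse arrows added. -/
def holonomy {K : Type*} [Group K] (φ : Δ.Edge → K) {i : Quiver.Symmetrify Δ.Tile} :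
    ∀ {j : Quiver.Symmetrify Δ.Tile}, Quiver.Path i j → K
  | _, .nil => 1
  | _, .cons p (Sum.inl a) => φ a.1 * holonomy φ p
  | _, .cons p (Sum.inr a) => (φ a.1)⁻¹ * holonomy φ p

section holonomy

variable {K L : Type*} [Group K] [Group L] (φ : Δ.Edge → K) {i j l : Quiver.Symmetrify Δ.Tile}

@[simp] theorem holonomy_nil : holonomy φ (Quiver.Path.nil : Quiver.Path i i) = 1 := by
  simp [holonomy]

theorem holonomy_comp (p : Quiver.Path i j) (q : Quiver.Path j l) :
    holonomy φ (p.comp q) = holonomy φ q * holonomy φ p := by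
  induction q with
  | nil => simp
  | cons q a ih => rcases a with a | a <;> simp [holonomy, ih, mul_assoc]

theorem holonomy_reverse (p : Quiver.Path i j) : holonomy φ p.reverse = (holonomy φ p)⁻¹ := by
  induction p with
  | nil => simp [Quiver.Path.reverse]
  | cons q a ih =>
    rw [Quiver.Path.reverse, holonomy_comp, ih]
    rcases a with a | a <;> simp [holonomy, Quiver.Hom.toPath, Quiver.symmetrify_reverse]

theorem map_holonomy (f : K →* L) (p : Quiver.Path i j) :
    f (holonomy φ p) = holonomy (fun x => f (φ x)) p := by
  induction p with
  | nil => simp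
  | cons q a ih => rcases a with a | a <;> simp [holonomy, ih]

theorem holonomy_mul {φ ψ : Δ.Edge → K} (h : ∀ e e', Commute (φ e) (ψ e')) (p : Quiver.Path i j) :
    holonomy (fun x => φ x * ψ x) p = holonomy φ p * holonomy ψ p := by
  have hc : ∀ e', ∀ {m} (q : Quiver.Path i m), Commute (holonomy φ q) (ψ e') := by
    intro e' m q
    induction q with
    | nil => simp
    | cons q a ih =>
      rcases a with a | a
      · exact (h _ _).mul_left ih
      · exact (h _ _).inv_left.mul_left ih
  induction p with
  | nil => simp
  | cons q a ih =>
    rcases a with a | a <;> simp only [holonomy, ih]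
    · rw [mul_assoc, mul_assoc, ← mul_assoc (ψ _), ← (hc _ q).eq, mul_assoc]
    · rw [((h a.1 a.1).eq), mul_inv_rev, mul_assoc, mul_assoc, ← mul_assoc (ψ _)⁻¹,
        ← (hc _ q).inv_right.eq, mul_assoc]

theorem holonomy_gauge (D : Δ.Tile → K) (p : Quiver.Path i j) :
    holonomy (fun e => D (leftTile e) * φ e * (D (rightTile e))⁻¹) p =
      D j * holonomy φ p * (D i)⁻¹ := by
  induction p with
  | nil => simp
  | cons q a ih =>
    rcases a with ⟨a, rfl, rfl⟩ | ⟨a, rfl, rfl⟩ <;> simp only [holonomy, ih] <;> group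

end holonomy

/-! ### Connectedness -/

variable (Δ) in
/-- The group generated by the two rotations acts transitively on the edges, i.e. the bipartite
graph is connected. -/
def IsTransitive : Prop :=
  ∀ S : Set Δ.Edge, S.Nonempty → (∀ e, Δ.σ e ∈ S ↔ e ∈ S) → (∀ e, Δ.τ e ∈ S ↔ e ∈ S) →
    ∀ e, e ∈ S

theorem exists_rightTile_eq (i : Δ.Tile) : ∃ e : Δ.Edge, rightTile e = i := by
  obtain ⟨e, rfl⟩ := Quotient.exists_rep i
  exact ⟨Δ.σ e, (leftTile_eq_rightTile_σ e).symm⟩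

/-- Crossing an edge shows that its two tiles are reachable together. As the left tile of `e` is the
right tile of `σ e`, and the right tile of `e` is the left tile of `τ e`, reachability is invariant
under both rotations. -/
theorem IsTransitive.exists_paths (h : Δ.IsTransitive) (i₀ : Quiver.Symmetrify Δ.Tile) :
    ∃ p : ∀ i : Quiver.Symmetrify Δ.Tile, Quiver.Path i₀ i, p i₀ = Quiver.Path.nil := by
  classical
  let S : Set Δ.Edge := {e | Nonempty (Quiver.Path i₀ (rightTile e : Quiver.Symmetrify Δ.Tile))}
  have key : ∀ e, Nonempty (Quiver.Path i₀ (leftTile e : Quiver.Symmetrify Δ.Tile)) ↔ e ∈ S :=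
    fun e => ⟨fun ⟨q⟩ => ⟨q.cons (Quiver.Hom.toNeg (dualArrow e))⟩,
      fun ⟨q⟩ => ⟨q.cons (Quiver.Hom.toPos (dualArrow e))⟩⟩
  have hS : ∀ e, e ∈ S := by
    refine h S ?_ (fun e => ?_) fun e => ?_
    · obtain ⟨e, he⟩ := exists_rightTile_eq (Δ := Δ) i₀
      exact ⟨e, by subst he; exact ⟨Quiver.Path.nil⟩⟩
    · rw [← key e, leftTile_eq_rightTile_σ]; rfl
    · rw [← key (Δ.τ e)]; rfl
  have hp : ∀ i : Quiver.Symmetrify Δ.Tile, Nonempty (Quiver.Path i₀ i) := fun i => by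
    obtain ⟨e, rfl⟩ := exists_rightTile_eq (Δ := Δ) i
    exact hS e
  refine ⟨Function.update (fun i => (hp i).some) i₀ Quiver.Path.nil, ?_⟩
  simp

/-! ### Integral gradings -/

open Classical in
/-- The image of a chain of edges under the boundary map: its total weight at every vertex. -/
def boundary (d : Δ.Edge → ℤ) : (Δ.White → ℤ) × (Δ.Black → ℤ) :=
  (fun v => ∑ e with white e = v, d e, fun v => ∑ e with black e = v, d e)

theorem boundary_add (d d' : Δ.Edge → ℤ) : boundary (d + d') = boundary d + boundary d' := by
  simp only [boundary, Pi.add_apply, Finset.sum_add_distrib]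
  rfl

theorem boundary_sub (d d' : Δ.Edge → ℤ) : boundary (d - d') = boundary d - boundary d' := by
  simp only [boundary, Pi.sub_apply, Finset.sum_sub_distrib]
  rfl

theorem boundary_sum {ι : Type*} (s : Finset ι) (d : ι → Δ.Edge → ℤ) :
    boundary (∑ i ∈ s, d i) = ∑ i ∈ s, boundary (d i) := by
  classical
  induction s using Finset.induction_on with
  | empty =>
    exact Prod.ext (funext fun v => by simp [boundary]) (funext fun v => by simp [boundary])
  | insert a s ha ih => rw [Finset.sum_insert ha, Finset.sum_insert ha, boundary_add, ih]

open Classical in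
theorem boundary_single (e : Δ.Edge) :
    boundary (Pi.single e 1) = (Pi.single (white e) 1, Pi.single (black e) 1) := by
  simp only [boundary, Finset.sum_filter, Prod.mk.injEq]
  constructor <;> funext v
  · rw [Finset.sum_eq_single e (by intro b _ hb; simp [Pi.single_eq_of_ne hb]) (by simp)]
    simp [Pi.single_apply, eq_comm]
  · rw [Finset.sum_eq_single e (by intro b _ hb; simp [Pi.single_eq_of_ne hb]) (by simp)]
    simp [Pi.single_apply, eq_comm]

theorem white_σ (e : Δ.Edge) : white (Δ.σ e) = white e :=
  Quotient.sound ⟨-1, by simp⟩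

theorem black_τ (e : Δ.Edge) : black (Δ.τ e) = black e :=
  Quotient.sound ⟨-1, by simp⟩

open Classical in
-- The chain is an alternating walk through the graph. Turning at a white vertex from `e` to `e'`
-- replaces the black end of `e` by that of `e'` on subtracting `e` and adding `e'`; turning at a
-- black vertex changes nothing.
theorem IsTransitive.exists_boundary_eq (h : Δ.IsTransitive) (w : Δ.White) (b : Δ.Black) :
    ∃ d : Δ.Edge → ℤ, boundary d = (Pi.single w 1, Pi.single b 1) := by
  obtain ⟨e₁, rfl⟩ := Quotient.exists_rep w
  obtain ⟨e₂, rfl⟩ := Quotient.exists_rep b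
  change ∃ d, boundary d = (Pi.single (white e₁) 1, Pi.single (black e₂) 1)
  have key : ∀ e e', white e = white e' →
      (∃ d, boundary d = (Pi.single (white e₁) 1, Pi.single (black e) 1)) →
      ∃ d, boundary d = (Pi.single (white e₁) 1, Pi.single (black e') 1) := by
    rintro e e' he ⟨d, hd⟩
    refine ⟨d - Pi.single e 1 + Pi.single e' 1, ?_⟩
    rw [boundary_add, boundary_sub, hd, boundary_single, boundary_single, he]
    simp
  refine h {e | ∃ d, boundary d = (Pi.single (white e₁) 1, Pi.single (black e) 1)}
    ⟨e₁, Pi.single e₁ 1, boundary_single e₁⟩ (fun e => ?_) (fun e => ?_) e₂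
  · exact ⟨key _ _ (white_σ e), key _ _ (white_σ e).symm⟩
  · simp only [Set.mem_ofPred_eq, black_τ]

open Classical in
-- The total weight of all edges counts the white vertices and also the black ones.
theorem IsGraded.card_white_eq (h : Δ.IsGraded) :
    Fintype.card Δ.White = Fintype.card Δ.Black := by
  obtain ⟨d, hw, hb⟩ := h
  have h1 : ∑ v : Δ.White, ∑ e with white e = v, d e = ∑ e, d e :=
    Finset.sum_fiberwise _ _ _
  have h2 : ∑ v : Δ.Black, ∑ e with black e = v, d e = ∑ e, d e :=
    Finset.sum_fiberwise _ _ _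
  simp only [hw] at h1
  simp only [hb] at h2
  have := h1.trans h2.symm
  simpa using this

/-- A bijection from white to black vertices is chosen, and integral chains joining the matched
pairs are added up; every vertex then has weight one. -/
theorem IsGraded.exists_integral (h : Δ.IsGraded) (hc : Δ.IsTransitive) :
    ∃ d : Δ.Edge → ℤ, boundary d = 1 := by
  classical
  obtain ⟨f⟩ := Fintype.card_eq.1 h.card_white_eq
  choose d hd using fun w => hc.exists_boundary_eq w (f w)
  refine ⟨∑ w, d w, ?_⟩
  rw [boundary_sum]
  simp only [hd]
  refine Prod.ext ?_ ?_
  · rw [Prod.fst_sum]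
    exact Finset.univ_sum_single (1 : Δ.White → ℤ)
  · rw [Prod.snd_sum, Equiv.sum_comp f fun b => (Pi.single b 1 : Δ.Black → ℤ)]
    exact Finset.univ_sum_single (1 : Δ.Black → ℤ)

theorem walkProd_gauge {K : Type*} [Group K] (φ : Δ.Edge → K) (D : Δ.Tile → K)
    (ρ : Equiv.Perm Δ.Edge) (hρ : ∀ e, leftTile e = rightTile (ρ e)) (e : Δ.Edge) (n : ℕ) :
    walkProd (fun e => D (leftTile e) * φ e * (D (rightTile e))⁻¹) ρ e n =
      D (rightTile ((ρ ^ n) e)) * walkProd φ ρ e n * (D (rightTile e))⁻¹ := by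
  induction n with
  | zero => simp [walkProd]
  | succ n ih =>
    rw [walkProd, ih, walkProd, hρ, pow_succ', Equiv.Perm.mul_apply]
    group

theorem cycleProd_gauge {K : Type*} [Group K] (φ : Δ.Edge → K) (D : Δ.Tile → K)
    (ρ : Equiv.Perm Δ.Edge) (hρ : ∀ e, leftTile e = rightTile (ρ e)) (e : Δ.Edge) :
    cycleProd (fun e => D (leftTile e) * φ e * (D (rightTile e))⁻¹) ρ e =
      D (rightTile e) * cycleProd φ ρ e * (D (rightTile e))⁻¹ := by
  rw [cycleProd, walkProd_gauge φ D ρ hρ, pow_minimalPeriod_apply]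
  rfl

/-- A gauge change by the weights of the paths `p i` gives these paths degree zero, so that the
grading descends to the vertex group. It does not affect closed cycles, since the target is
commutative. -/
theorem IsGraded.exists_normalized (h : Δ.IsGraded) (hc : Δ.IsTransitive)
    {i₀ : Quiver.Symmetrify Δ.Tile} {p : ∀ i : Quiver.Symmetrify Δ.Tile, Quiver.Path i₀ i}
    (hp : p i₀ = Quiver.Path.nil) :
    ∃ d : Δ.Edge → Multiplicative ℤ,
      (∀ e, cycleProd d Δ.σ e = Multiplicative.ofAdd 1) ∧
      (∀ e, cycleProd d Δ.τ.symm e = Multiplicative.ofAdd 1) ∧ ∀ i, holonomy d (p i) = 1 := by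
  classical
  obtain ⟨d, hd⟩ := h.exists_integral hc
  obtain ⟨hw, hb⟩ := Prod.ext_iff.1 hd
  let d' : Δ.Edge → Multiplicative ℤ := fun e => Multiplicative.ofAdd (d e)
  let D : Δ.Tile → Multiplicative ℤ := fun i => (holonomy d' (p i))⁻¹
  refine ⟨fun e => D (leftTile e) * d' e * (D (rightTile e))⁻¹, fun e => ?_, fun e => ?_,
    fun i => ?_⟩
  · rw [cycleProd_gauge d' D _ leftTile_eq_rightTile_σ, cycleProd_ofAdd, mul_comm (D _),
      mul_inv_cancel_right]
    refine congrArg _ (Eq.trans ?_ (congrFun hw (white e)))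
    refine Finset.sum_congr (Finset.filter_congr fun x _ => ?_) fun _ _ => rfl
    exact (Quotient.eq (r := Equiv.Perm.SameCycle.setoid Δ.σ)).symm
  · rw [cycleProd_gauge d' D _ leftTile_eq_rightTile_τ_symm, cycleProd_ofAdd, mul_comm (D _),
      mul_inv_cancel_right]
    refine congrArg _ (Eq.trans ?_ (congrFun hb (black e)))
    refine Finset.sum_congr (Finset.filter_congr fun x _ => ?_) fun _ _ => rfl
    refine Iff.trans ?_ (Quotient.eq (r := Equiv.Perm.SameCycle.setoid Δ.τ)).symm
    exact Equiv.Perm.sameCycle_inv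
  · rw [holonomy_gauge]
    simp [D, hp]

/-! ### The groups presented by a brane tiling -/

section Groups

variable {i₀ : Quiver.Symmetrify Δ.Tile} (p : ∀ i : Quiver.Symmetrify Δ.Tile, Quiver.Path i₀ i)

/-- The relations that identify the cycles around the two endpoints of every edge, and kill the
given paths. -/
def vertexRels : Set (FreeGroup Δ.Edge) :=
  Set.range (fun e => cycleProd FreeGroup.of Δ.σ e * (cycleProd FreeGroup.of Δ.τ.symm e)⁻¹) ∪
    Set.range fun i => holonomy FreeGroup.of (p i)

/-- The vertex group of the fundamental groupoid of the dual quiver with the relations given by the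
potential. -/
abbrev VertexGroup := PresentedGroup (vertexRels p)

/-- The relations that kill the cycles around all the vertices, and the given paths. -/
def surfaceRels : Set (FreeGroup Δ.Edge) :=
  (Set.range (fun e => cycleProd FreeGroup.of Δ.σ e) ∪
    Set.range fun e => cycleProd FreeGroup.of Δ.τ.symm e) ∪
    Set.range fun i => holonomy FreeGroup.of (p i)

/-- The combinatorial fundamental group of the surface. -/
abbrev SurfaceGroup := PresentedGroup (surfaceRels p)

variable {p} {K : Type*} [Group K]

/-- Homomorphisms out of the vertex group. -/
def VertexGroup.lift (φ : Δ.Edge → K) (h : ∀ e, cycleProd φ Δ.σ e = cycleProd φ Δ.τ.symm e)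
    (hp : ∀ i, holonomy φ (p i) = 1) : VertexGroup p →* K :=
  PresentedGroup.toGroup (f := φ) (by
    rintro _ (⟨e, rfl⟩ | ⟨i, rfl⟩)
    · simp [map_cycleProd, h]
    · simp [map_holonomy, hp])

@[simp] theorem VertexGroup.lift_of (φ : Δ.Edge → K) (h) (hp) (e : Δ.Edge) :
    VertexGroup.lift (p := p) φ h hp (PresentedGroup.of e) = φ e :=
  PresentedGroup.toGroup.of _

theorem VertexGroup.cycleProd_eq (e : Δ.Edge) :
    cycleProd (PresentedGroup.of (rels := vertexRels p)) Δ.σ e =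
      cycleProd PresentedGroup.of Δ.τ.symm e := by
  have h : PresentedGroup.mk (vertexRels p) _ = 1 :=
    PresentedGroup.one_of_mem (Or.inl ⟨e, rfl⟩)
  rw [map_mul, map_inv, map_cycleProd, map_cycleProd, mul_inv_eq_one] at h
  exact h

theorem VertexGroup.holonomy_eq (i : Quiver.Symmetrify Δ.Tile) :
    holonomy (PresentedGroup.of (rels := vertexRels p)) (p i) = 1 := by
  have h : PresentedGroup.mk (vertexRels p) _ = 1 :=
    PresentedGroup.one_of_mem (Or.inr ⟨i, rfl⟩)
  rw [map_holonomy] at h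
  exact h

/-- Homomorphisms out of the surface group. -/
def SurfaceGroup.lift (φ : Δ.Edge → K) (hσ : ∀ e, cycleProd φ Δ.σ e = 1)
    (hτ : ∀ e, cycleProd φ Δ.τ.symm e = 1) (hp : ∀ i, holonomy φ (p i) = 1) :
    SurfaceGroup p →* K :=
  PresentedGroup.toGroup (f := φ) (by
    rintro _ ((⟨e, rfl⟩ | ⟨e, rfl⟩) | ⟨i, rfl⟩)
    · simp [map_cycleProd, hσ]
    · simp [map_cycleProd, hτ]
    · simp [map_holonomy, hp])

@[simp] theorem SurfaceGroup.lift_of (φ : Δ.Edge → K) (hσ) (hτ) (hp) (e : Δ.Edge) :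
    SurfaceGroup.lift (p := p) φ hσ hτ hp (PresentedGroup.of e) = φ e :=
  PresentedGroup.toGroup.of _

theorem SurfaceGroup.cycleProd_σ (e : Δ.Edge) :
    cycleProd (PresentedGroup.of (rels := surfaceRels p)) Δ.σ e = 1 := by
  have h : PresentedGroup.mk (surfaceRels p) _ = 1 :=
    PresentedGroup.one_of_mem (Or.inl (Or.inl ⟨e, rfl⟩))
  rw [map_cycleProd] at h
  exact h

theorem SurfaceGroup.cycleProd_τ_symm (e : Δ.Edge) :
    cycleProd (PresentedGroup.of (rels := surfaceRels p)) Δ.τ.symm e = 1 := by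
  have h : PresentedGroup.mk (surfaceRels p) _ = 1 :=
    PresentedGroup.one_of_mem (Or.inl (Or.inr ⟨e, rfl⟩))
  rw [map_cycleProd] at h
  exact h

theorem SurfaceGroup.holonomy_eq (i : Quiver.Symmetrify Δ.Tile) :
    holonomy (PresentedGroup.of (rels := surfaceRels p)) (p i) = 1 := by
  have h : PresentedGroup.mk (surfaceRels p) _ = 1 :=
    PresentedGroup.one_of_mem (Or.inr ⟨i, rfl⟩)
  rw [map_holonomy] at h
  exact h

/-- If the cycles around the two endpoints of every edge agree, and the paths from the base tile to
all the tiles are trivial, then all the cycles agree and are central. -/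
theorem exists_central_cycleProd {φ : Δ.Edge → K}
    (h : ∀ e, cycleProd φ Δ.σ e = cycleProd φ Δ.τ.symm e) (hp : ∀ i, holonomy φ (p i) = 1) :
    ∃ c : K, (∀ e, cycleProd φ Δ.σ e = c) ∧ ∀ e, Commute c (φ e) := by
  have hσ := cycleProd_apply_mul φ Δ.σ
  have hτ : ∀ e, cycleProd φ Δ.σ (Δ.τ.symm e) * φ e = φ e * cycleProd φ Δ.σ e := fun e => by
    rw [h, h]
    exact cycleProd_apply_mul φ Δ.τ.symm e
  -- The cycle based at a tile: `σ e` has the left tile of `e` on its right. Well-definedness holds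
  -- because `hσ` and `hτ` express the cycles at `σ e` and `τ⁻¹ e` as the same conjugate of the
  -- cycle at `e`.
  let C : Δ.Tile → K := Quotient.lift (fun e => cycleProd φ Δ.σ (Δ.σ e)) (by
    intro x y hxy
    refine eq_of_sameCycle (F := fun e => cycleProd φ Δ.σ (Δ.σ e)) (fun e => ?_) hxy
    have h1 := (hσ (Δ.τ (Δ.σ e))).trans (hτ _).symm
    simpa using h1)
  have hC : ∀ e, C (leftTile e) = cycleProd φ Δ.σ (Δ.σ e) := fun e => rfl
  have hC' : ∀ e, C (rightTile e) = cycleProd φ Δ.σ e := fun e => by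
    obtain ⟨e, rfl⟩ := Δ.σ.surjective e
    rw [← leftTile_eq_rightTile_σ, hC]
  have hCφ : ∀ e, C (leftTile e) * φ e = φ e * C (rightTile e) := fun e => by
    rw [hC, hC', hσ]
  have hhol : ∀ {i j : Quiver.Symmetrify Δ.Tile} (q : Quiver.Path i j),
      C j * holonomy φ q = holonomy φ q * C i := by
    intro i j q
    induction q with
    | nil => simp
    | cons q a ih =>
      rcases a with ⟨a, rfl, rfl⟩ | ⟨a, rfl, rfl⟩ <;> simp only [holonomy]
      · rw [← mul_assoc, hCφ, mul_assoc, ih, mul_assoc]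
      · rw [mul_assoc, ← ih, ← mul_assoc, ← mul_assoc, eq_inv_mul_of_mul_eq (hCφ a).symm]
        group
  -- Transport along `p i` conjugates by its holonomy, which is trivial.
  have hconst : ∀ i : Δ.Tile, C i = C i₀ := fun i => by
    have h1 := hhol (p i)
    rw [hp i, mul_one, one_mul] at h1
    exact h1
  refine ⟨C i₀, fun e => by rw [← hC', hconst], fun e => ?_⟩
  have := hCφ e
  rwa [hconst, hconst (rightTile e)] at this

theorem walkProd_zpow_inv (d : Δ.Edge → Multiplicative ℤ) (c : K) (ρ : Equiv.Perm Δ.Edge)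
    (e : Δ.Edge) : cycleProd (fun e => zpowersHom K c (d e)⁻¹) ρ e =
      zpowersHom K c (cycleProd d ρ e)⁻¹ := by
  rw [← map_cycleProd (zpowersHom K c) (fun e => (d e)⁻¹)]
  congr 1
  exact (map_cycleProd (invMonoidHom (α := Multiplicative ℤ)) d ρ e).symm

/-- One direction is the quotient map paired with the degree. The inverse uses the degree-zero
correction of each generator by a power of the central element `c`. -/
theorem IsGraded.nonempty_mulEquiv (h : Δ.IsGraded) (hc : Δ.IsTransitive)
    (hp : p i₀ = Quiver.Path.nil) (e₀ : Δ.Edge) :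
    Nonempty (VertexGroup p ≃* SurfaceGroup p × Multiplicative ℤ) := by
  obtain ⟨d, hdσ, hdτ, hdp⟩ := h.exists_normalized hc hp
  obtain ⟨c, hcσ, hcc⟩ := exists_central_cycleProd (p := p)
    (VertexGroup.cycleProd_eq (p := p)) VertexGroup.holonomy_eq
  let s : Δ.Edge → SurfaceGroup p := PresentedGroup.of
  let t : Δ.Edge → VertexGroup p := PresentedGroup.of
  let φ : Δ.Edge → SurfaceGroup p × Multiplicative ℤ := fun e => (s e, d e)
  have hφ1 : ∀ ρ e, (cycleProd φ ρ e).1 = cycleProd s ρ e := fun ρ e =>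
    map_cycleProd (MonoidHom.fst _ _) φ ρ e
  have hφ2 : ∀ ρ e, (cycleProd φ ρ e).2 = cycleProd d ρ e := fun ρ e =>
    map_cycleProd (MonoidHom.snd _ _) φ ρ e
  have hφh1 : ∀ i, (holonomy φ (p i)).1 = holonomy s (p i) := fun i =>
    map_holonomy φ (MonoidHom.fst _ _) (p i)
  have hφh2 : ∀ i, (holonomy φ (p i)).2 = holonomy d (p i) := fun i =>
    map_holonomy φ (MonoidHom.snd _ _) (p i)
  let z : Multiplicative ℤ →* VertexGroup p := zpowersHom _ c
  have hz : ∀ (e : Δ.Edge) (n : Multiplicative ℤ), Commute (t e) (z n) := fun e n => by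
    rw [zpowersHom_apply]
    exact ((hcc e).symm).zpow_right _
  have hzc : z (Multiplicative.ofAdd 1) = c := by simp [z]
  -- Each cycle has degree one and value `c`, so this correction turns its product into `c * c⁻¹ =
  -- 1` and respects the surface relations.
  let ψ : Δ.Edge → VertexGroup p := fun e => t e * z (d e)⁻¹
  have hψ : ∀ ρ e, cycleProd ψ ρ e = cycleProd t ρ e * z (cycleProd d ρ e)⁻¹ := fun ρ e => by
    rw [← walkProd_zpow_inv, cycleProd, walkProd_mul fun e e' => hz e _]
    rfl
  let F : VertexGroup p →* SurfaceGroup p × Multiplicative ℤ := VertexGroup.lift φ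
    (fun e => Prod.ext
      (by rw [hφ1, hφ1, SurfaceGroup.cycleProd_σ, SurfaceGroup.cycleProd_τ_symm])
      (by rw [hφ2, hφ2, hdσ, hdτ]))
    (fun i => Prod.ext (by rw [hφh1, SurfaceGroup.holonomy_eq, Prod.fst_one])
      (by rw [hφh2, hdp, Prod.snd_one]))
  let B₁ : SurfaceGroup p →* VertexGroup p := SurfaceGroup.lift ψ
    (fun e => by rw [hψ, hcσ, hdσ, map_inv, hzc, mul_inv_cancel])
    (fun e => by
      rw [hψ, ← VertexGroup.cycleProd_eq, hcσ, hdτ, map_inv, hzc, mul_inv_cancel])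
    (fun i => by
      have h1 : holonomy (fun e => z (d e)⁻¹) (p i) = 1 := by
        have h2 := map_holonomy d (z.comp (invMonoidHom (α := Multiplicative ℤ))) (p i)
        rw [hdp, map_one] at h2
        exact h2.symm
      rw [holonomy_mul (φ := t) fun e e' => hz e _, h1, VertexGroup.holonomy_eq, mul_one])
  have hcomm : ∀ x n, Commute (B₁ x) (z n) := fun x n => by
    induction x using PresentedGroup.induction_on with
    | _ x =>
    induction x using FreeGroup.induction_on with
    | C1 => simp
    | of e =>
      change Commute (B₁ (PresentedGroup.of e)) (z n)
      rw [SurfaceGroup.lift_of]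
      exact (hz e n).mul_left ((Commute.all _ _).map z)
    | inv_of e ih => rw [map_inv, map_inv]; exact ih.inv_left
    | mul x y hx hy => rw [map_mul, map_mul]; exact hx.mul_left hy
  let B : SurfaceGroup p × Multiplicative ℤ →* VertexGroup p := B₁.noncommCoprod z hcomm
  refine ⟨MonoidHom.toMulEquiv F B ?_ ?_⟩
  · refine PresentedGroup.ext fun e => ?_
    simp only [MonoidHom.comp_apply, F, VertexGroup.lift_of, φ, B, MonoidHom.noncommCoprod_apply,
      MonoidHom.id_apply, s, B₁, SurfaceGroup.lift_of, ψ, map_inv, inv_mul_cancel_right]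
    rfl
  · have hFc : F c = (1, Multiplicative.ofAdd 1) := by
      rw [← hcσ e₀, map_cycleProd]
      refine Prod.ext ?_ ?_
      · simp only [F, VertexGroup.lift_of]
        rw [hφ1, SurfaceGroup.cycleProd_σ]
      · simp only [F, VertexGroup.lift_of]
        rw [hφ2, hdσ]
    have hFz : ∀ n, F (z n) = (1, n) := fun n =>
      DFunLike.congr_fun (MonoidHom.ext_mint (f := F.comp z) (g := MonoidHom.inr _ _)
        (by rw [MonoidHom.comp_apply, hzc, hFc]; rfl)) n
    have hFB : F.comp B₁ = MonoidHom.inl _ _ := PresentedGroup.ext fun e => by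
      simp only [MonoidHom.comp_apply, B₁, SurfaceGroup.lift_of, ψ, map_mul, hFz, t, F,
        VertexGroup.lift_of]
      simp [φ, s]
    refine MonoidHom.ext fun ⟨x, n⟩ => ?_
    rw [MonoidHom.comp_apply, MonoidHom.noncommCoprod_apply, map_mul, hFz, ← MonoidHom.comp_apply F,
      hFB]
    simp

end Groups

end BipartiteRotationSystem

/-! ### Homotopy classes of paths -/

instance : ContractibleSpace unitInterval :=
  (convex_Icc (0 : ℝ) 1).contractibleSpace ⟨0, by simp⟩

section PathClasses

open Set Topology

variable {X : Type*} [TopologicalSpace X]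

namespace Path.Homotopic.Quotient

theorem cast_trans {x y z x' y' z' : X} (γ : Path.Homotopic.Quotient x y)
    (δ : Path.Homotopic.Quotient y z) (hx : x' = x) (hy : y' = y) (hz : z' = z) :
    (γ.trans δ).cast hx hz = (γ.cast hx hy).trans (δ.cast hy hz) := by
  subst hx hy hz
  simp

theorem map_trans {Y : Type*} [TopologicalSpace Y] {x y z : X} (γ : Path.Homotopic.Quotient x y)
    (δ : Path.Homotopic.Quotient y z) (f : C(X, Y)) :
    (γ.trans δ).map f = (γ.map f).trans (δ.map f) := by
  obtain ⟨γ⟩ := γ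
  obtain ⟨δ⟩ := δ
  exact congrArg mk (Path.map_trans γ δ f.continuous)

/-- A property of homotopy classes of paths that is stable under composition and holds for the paths
contained in the members of an open cover holds for all paths. -/
theorem induction_of_open_cover {ι : Type*} {U : ι → Set X} (hU : ∀ i, IsOpen (U i))
    (hcov : ∀ x, ∃ i, x ∈ U i) {S : ∀ {x y : X}, Path.Homotopic.Quotient x y → Prop}
    (htrans : ∀ {x y z : X} (γ : Path.Homotopic.Quotient x y) (δ : Path.Homotopic.Quotient y z),
      S γ → S δ → S (γ.trans δ))
    (hS : ∀ i {x y : X} (γ : Path x y), range γ ⊆ U i → S (mk γ))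
    {x y : X} (γ : Path.Homotopic.Quotient x y) : S γ := by
  obtain ⟨γ, rfl⟩ := mk_surjective γ
  -- A Lebesgue subdivision: each piece of `γ` between consecutive `t n` lies in a single member of
  -- the cover.
  obtain ⟨t, ht0, hmono, ⟨n, hn⟩, ht⟩ :=
    exists_monotone_Icc_subset_open_cover_unitInterval (c := fun i => γ ⁻¹' U i)
      (fun i => (hU i).preimage γ.continuous)
      (fun s _ => mem_iUnion.2 (hcov (γ s)))
  have hrefl : S (mk (γ.subpath 0 0)) := by
    obtain ⟨i, hi⟩ := hcov (γ 0)
    refine hS i _ ?_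
    rw [Path.range_subpath]
    simpa using hi
  have key : ∀ n, ∀ s, s = t n → S (mk (γ.subpath 0 s)) := by
    intro n
    induction n with
    | zero =>
      rintro s rfl
      rw [ht0]
      exact hrefl
    | succ n ih =>
      rintro s rfl
      have h1 : mk (γ.subpath 0 (t (n + 1))) =
          (mk (γ.subpath 0 (t n))).trans (mk (γ.subpath (t n) (t (n + 1)))) :=
        (Path.Homotopic.Quotient.eq.2
          ⟨Path.Homotopy.subpathTransSubpath γ 0 (t n) (t (n + 1))⟩).symm
      rw [h1]
      refine htrans _ _ (ih _ rfl) ?_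
      obtain ⟨i, hi⟩ := ht n
      refine hS i _ ?_
      rw [Path.range_subpath_of_le _ _ _ (hmono n.le_succ)]
      exact image_subset_iff.2 hi
  have h1 := key n 1 (hn n le_rfl).symm
  rw [Path.subpath_zero_one] at h1
  -- The full subpath is `γ` with its endpoints written as `γ 0` and `γ 1`.
  have hcast : ∀ {x' y' : X} (hx : x' = x) (hy : y' = y), S (mk (γ.cast hx hy)) → S (mk γ) := by
    rintro _ _ rfl rfl h
    simpa using h
  exact hcast _ _ h1

/-- A path in a subset that is contracted to a point is homotopic to the composition of the traces
of its endpoints. -/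
theorem mk_eq_of_contraction {U : Set X} {H : X → unitInterval → X}
    (hH : Continuous fun q : U × unitInterval => H q.1 q.2) (h0 : ∀ x ∈ U, H x 0 = x) {v : X}
    (h1 : ∀ x ∈ U, H x 1 = v) {x y : X} {γ : Path x y} (hγ : range γ ⊆ U) {α : Path x v}
    (hα : ∀ t, α t = H x t) {β : Path y v} (hβ : ∀ t, β t = H y t) :
    mk γ = (mk α).trans (mk β).symm := by
  have hmem : ∀ t, γ t ∈ U := fun t => hγ (mem_range_self t)
  -- The contraction applied along `γ`: the sides of the square are `γ`, the two traces `α` and `β`,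
  -- and the constant path at `v`. In the simply connected square, the two ways from corner to
  -- opposite corner are homotopic.
  let K : C(unitInterval × unitInterval, X) := ⟨fun a => H (γ a.1) a.2,
    hH.comp (((γ.continuous.subtype_mk hmem).comp continuous_fst).prodMk continuous_snd)⟩
  let bottom : Path ((0, 0) : unitInterval × unitInterval) (1, 0) :=
    ⟨⟨fun t => (t, 0), by fun_prop⟩, rfl, rfl⟩
  let right : Path ((1, 0) : unitInterval × unitInterval) (1, 1) :=
    ⟨⟨fun t => (1, t), by fun_prop⟩, rfl, rfl⟩
  let left : Path ((0, 0) : unitInterval × unitInterval) (0, 1) :=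
    ⟨⟨fun t => (0, t), by fun_prop⟩, rfl, rfl⟩
  let top : Path ((0, 1) : unitInterval × unitInterval) (1, 1) :=
    ⟨⟨fun t => (t, 1), by fun_prop⟩, rfl, rfl⟩
  have hsq : (mk bottom).trans (mk right) = (mk left).trans (mk top) := Subsingleton.elim _ _
  have h00 : x = K (0, 0) := ((h0 _ (hmem 0)).trans γ.source).symm
  have h10 : y = K (1, 0) := ((h0 _ (hmem 1)).trans γ.target).symm
  have h01 : v = K (0, 1) := (h1 _ (hmem 0)).symm
  have h11 : v = K (1, 1) := (h1 _ (hmem 1)).symm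
  have h2 := congrArg (fun δ => (δ.map K).cast h00 h11) hsq
  simp only [map_trans] at h2
  rw [cast_trans _ _ _ h10, cast_trans _ _ _ h01] at h2
  have e1 : ((mk bottom).map K).cast h00 h10 = mk γ :=
    congrArg mk (Path.ext (funext fun t => h0 _ (hmem t)))
  have e2 : ((mk right).map K).cast h10 h11 = mk β :=
    congrArg mk (Path.ext (funext fun t => by simp [K, right, hβ]))
  have e3 : ((mk left).map K).cast h00 h01 = mk α :=
    congrArg mk (Path.ext (funext fun t => by simp [K, left, hα]))
  have e4 : ((mk top).map K).cast h01 h11 = refl v :=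
    congrArg mk (Path.ext (funext fun t => h1 _ (hmem t)))
  rw [e1, e2, e3, e4, trans_refl] at h2
  rw [← h2, trans_assoc, trans_symm, trans_refl]

end Path.Homotopic.Quotient

end PathClasses

namespace BipartiteRotationSystem

open Set Topology

variable {Δ : BipartiteRotationSystem}

/-! ### The squares of the realization -/

/-- The square of an edge. -/
def square (e : Δ.Edge) : C(unitInterval × unitInterval, Δ.Realization) :=
  ⟨fun a => Quot.mk _ ⟨e, a⟩, continuous_quot_mk.comp continuous_sigmaMk⟩

theorem square_white (e : Δ.Edge) (t : unitInterval) : square e (0, t) = square (Δ.σ e) (t, 0) :=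
  Quot.sound (.white e t)

theorem square_black (e : Δ.Edge) (t : unitInterval) : square e (1, t) = square (Δ.τ e) (t, 1) :=
  Quot.sound (.black e t)

/-- The straight path between two points of the unit square. -/
def squareLine (a b : unitInterval × unitInterval) : Path a b where
  toFun t := (Icc.convexComb a.1 b.1 t, Icc.convexComb a.2 b.2 t)
  continuous_toFun := by fun_prop
  source' := by simp
  target' := by simp

/-- The class of the straight path between two points of the square of an edge. -/
def lineClass (e : Δ.Edge) (a b : unitInterval × unitInterval) {x y : Δ.Realization}
    (hx : square e a = x) (hy : square e b = y) : Path.Homotopic.Quotient x y :=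
  ((Path.Homotopic.Quotient.mk (squareLine a b)).map (square e)).cast hx.symm hy.symm

theorem lineClass_trans (e : Δ.Edge) {a b c : unitInterval × unitInterval} {x y z : Δ.Realization}
    (hx : square e a = x) (hy : square e b = y) (hz : square e c = z) :
    (lineClass e a b hx hy).trans (lineClass e b c hy hz) = lineClass e a c hx hz := by
  subst hx hy hz
  simp only [lineClass, Path.Homotopic.Quotient.cast_rfl_rfl]
  rw [← Path.Homotopic.Quotient.map_trans]
  congr 1
  exact Subsingleton.elim _ _

theorem lineClass_self (e : Δ.Edge) {a : unitInterval × unitInterval} {x : Δ.Realization}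
    (hx : square e a = x) : lineClass e a a hx hx = .refl x := by
  subst hx
  simp only [lineClass, Path.Homotopic.Quotient.cast_rfl_rfl]
  rw [Subsingleton.elim (Path.Homotopic.Quotient.mk (squareLine a a)) (.refl a)]
  rfl

theorem lineClass_symm (e : Δ.Edge) {a b : unitInterval × unitInterval} {x y : Δ.Realization}
    (hx : square e a = x) (hy : square e b = y) :
    (lineClass e a b hx hy).symm = lineClass e b a hy hx := by
  have h := congrArg (fun γ => (lineClass e a b hx hy).symm.trans γ)
    (lineClass_trans e hx hy hx)
  simp only [lineClass_self, Path.Homotopic.Quotient.trans_refl] at h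
  rw [← h, ← Path.Homotopic.Quotient.trans_assoc, Path.Homotopic.Quotient.symm_trans,
    Path.Homotopic.Quotient.refl_trans]

theorem lineClass_white (e : Δ.Edge) (s t : unitInterval) {x y : Δ.Realization}
    (hx : square e (0, s) = x) (hy : square e (0, t) = y) :
    lineClass e (0, s) (0, t) hx hy = lineClass (Δ.σ e) (s, 0) (t, 0)
      ((square_white e s).symm.trans hx) ((square_white e t).symm.trans hy) :=
  congrArg Path.Homotopic.Quotient.mk (Path.ext (funext fun r => by
    simp only [Path.cast_coe, Path.map_coe, Function.comp_apply, squareLine, Path.coe_mk_mk,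
      Icc.convexComb_eq]
    exact square_white _ _))

theorem lineClass_black (e : Δ.Edge) (s t : unitInterval) {x y : Δ.Realization}
    (hx : square e (1, s) = x) (hy : square e (1, t) = y) :
    lineClass e (1, s) (1, t) hx hy = lineClass (Δ.τ e) (s, 1) (t, 1)
      ((square_black e s).symm.trans hx) ((square_black e t).symm.trans hy) :=
  congrArg Path.Homotopic.Quotient.mk (Path.ext (funext fun r => by
    simp only [Path.cast_coe, Path.map_coe, Function.comp_apply, squareLine, Path.coe_mk_mk,
      Icc.convexComb_eq]
    exact square_black _ _))

/-! ### Stars -/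

/-- The motion of a point of a square along a straight line towards the corner given by `κ`, if
any. -/
def starMotion (κ : Δ.Edge → unitInterval × unitInterval → Option (unitInterval × unitInterval))
    (z : Σ _ : Δ.Edge, unitInterval × unitInterval) (r : unitInterval) : Δ.Realization :=
  match κ z.1 z.2 with
  | some c => square z.1 (squareLine z.2 c r)
  -- Points outside all stars stay put, so that the motion is defined on the whole realization;
  -- continuity is claimed only on the stars.
  | none => square z.1 z.2

/-- A function that assigns to every point in an open subset of the realization a corner of the
square of which it is a point, compatibly with the gluing of the squares. -/
structure IsStar (κ : Δ.Edge → unitInterval × unitInterval → Option (unitInterval × unitInterval)) :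
    Prop where
  isOpen : ∀ e c, IsOpen {a | κ e a = some c}
  isSome_iff : ∀ z z', Δ.GluingRel z z' → ((κ z.1 z.2).isSome ↔ (κ z'.1 z'.2).isSome)
  motion_eq : ∀ z z', Δ.GluingRel z z' → ∀ r, starMotion κ z r = starMotion κ z' r

namespace IsStar

variable {κ : Δ.Edge → unitInterval × unitInterval → Option (unitInterval × unitInterval)}

/-- The points of the realization in the star of the vertex `v`. -/
def star (h : IsStar κ) (v : Δ.Realization) : Set Δ.Realization :=
  {x | Quot.lift (fun z => (κ z.1 z.2).isSome ∧ starMotion κ z 1 = v)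
    (fun z z' hz => by rw [h.motion_eq z z' hz, h.isSome_iff z z' hz]) x}

theorem square_mem_star (h : IsStar κ) {v : Δ.Realization} {e : Δ.Edge}
    {a : unitInterval × unitInterval} :
    square e a ∈ h.star v ↔ ∃ c, κ e a = some c ∧ square e c = v := by
  change (κ e a).isSome ∧ starMotion κ ⟨e, a⟩ 1 = v ↔ _
  rw [Option.isSome_iff_exists]
  constructor
  · rintro ⟨⟨c, hc⟩, hv⟩
    refine ⟨c, hc, ?_⟩
    simpa [starMotion, hc] using hv
  · rintro ⟨c, hc, hv⟩
    exact ⟨⟨c, hc⟩, by simpa [starMotion, hc] using hv⟩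

theorem isOpen_star (h : IsStar κ) (v : Δ.Realization) : IsOpen (h.star v) := by
  rw [← isQuotientMap_quot_mk.isOpen_preimage, isOpen_sigma_iff]
  intro e
  have : (Sigma.mk e ⁻¹' (Quot.mk Δ.GluingRel ⁻¹' h.star v)) =
      ⋃ c : {c : unitInterval × unitInterval // square e c = v}, {a | κ e a = some c} := by
    ext a
    simp only [mem_preimage, mem_iUnion]
    refine (h.square_mem_star (e := e) (a := a)).trans ⟨?_, ?_⟩
    · rintro ⟨c, hc, hv⟩
      exact ⟨⟨c, hv⟩, hc⟩
    · rintro ⟨⟨c, hv⟩, hc⟩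
      exact ⟨c, hc, hv⟩
  rw [this]
  exact isOpen_iUnion fun c => h.isOpen e c

/-- The contraction of the stars to their centres. -/
def contraction (h : IsStar κ) (x : Δ.Realization) (r : unitInterval) : Δ.Realization :=
  Quot.lift (fun z => starMotion κ z r) (fun z z' hz => h.motion_eq z z' hz r) x

theorem contraction_square (h : IsStar κ) {e : Δ.Edge} {a c : unitInterval × unitInterval}
    (hc : κ e a = some c) (r : unitInterval) :
    h.contraction (square e a) r = square e (squareLine a c r) := by
  change starMotion κ ⟨e, a⟩ r = _
  simp [starMotion, hc]

theorem continuous_contraction (h : IsStar κ) (v : Δ.Realization) :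
    Continuous fun q : h.star v × unitInterval => h.contraction q.1 q.2 := by
  -- The gluing map stays a quotient map over an open set, and also after taking the product with
  -- the interval, so continuity can be checked on the squares.
  have hq := (isQuotientMap_quot_mk (r := Δ.GluingRel)).restrictPreimage_isOpen (h.isOpen_star v)
  refine hq.continuous_lift_prod_left
    (g := fun q : h.star v × unitInterval => h.contraction q.1 q.2) ?_
  have hcont : ∀ z ∈ Quot.mk Δ.GluingRel ⁻¹' h.star v, ∀ r, ContinuousAt
      (fun q : (Σ _ : Δ.Edge, unitInterval × unitInterval) × unitInterval =>
        starMotion κ q.1 q.2) (z, r) := by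
    rintro ⟨e, a⟩ hz r
    obtain ⟨c, hc, -⟩ := h.square_mem_star.1 hz
    refine ((Topology.IsOpenEmbedding.sigmaMk
      (σ := fun _ : Δ.Edge => unitInterval × unitInterval) (i := e)).prodMap
      (IsOpenEmbedding.id (X := unitInterval))).continuousAt_iff (x := (a, r)) |>.1 ?_
    -- The corner is locally constant, so near `(a, r)` the motion is a straight-line homotopy to
    -- the fixed point `c`.
    have hev : (fun q : (unitInterval × unitInterval) × unitInterval =>
        square e (squareLine q.1 c q.2)) =ᶠ[𝓝 (a, r)] fun q => starMotion κ ⟨e, q.1⟩ q.2 := by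
      filter_upwards [((h.isOpen e c).preimage continuous_fst).mem_nhds hc] with q hq
      have hq' : κ e q.1 = some c := hq
      simp [starMotion, hq']
    refine ContinuousAt.congr (Continuous.continuousAt ?_) hev
    refine (square e).continuous.comp ?_
    simp only [squareLine, Path.coe_mk_mk]
    exact (Icc.continuous_convexComb_prod.comp (by fun_prop : Continuous
      fun q : (unitInterval × unitInterval) × unitInterval => (q.1.1, c.1, q.2))).prodMk
      (Icc.continuous_convexComb_prod.comp (by fun_prop : Continuous
      fun q : (unitInterval × unitInterval) × unitInterval => (q.1.2, c.2, q.2)))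
  refine continuous_iff_continuousAt.2 fun ⟨⟨z, hz⟩, r⟩ => ?_
  exact ContinuousAt.comp
    (g := fun q : (Σ _ : Δ.Edge, unitInterval × unitInterval) × unitInterval =>
      starMotion κ q.1 q.2)
    (x := (⟨z, hz⟩, r)) (f := fun q : (Quot.mk Δ.GluingRel ⁻¹' h.star v) × unitInterval =>
    ((q.1 : Σ _ : Δ.Edge, unitInterval × unitInterval), q.2)) (hcont z hz r)
    (Continuous.continuousAt (by fun_prop))

/-- Inside a star only the endpoints matter: the path may be replaced by a segment to the centre and
a segment back, each taken in any square that represents the endpoint. -/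
theorem mk_eq (h : IsStar κ) {v x y : Δ.Realization} {γ : Path x y} (hγ : range γ ⊆ h.star v)
    {e e' : Δ.Edge} {a a' : unitInterval × unitInterval} (hx : square e a = x)
    (hy : square e' a' = y) : ∃ c c', ∃ (hc : square e c = v) (hc' : square e' c' = v),
      Path.Homotopic.Quotient.mk γ =
        (lineClass e a c hx hc).trans (lineClass e' a' c' hy hc').symm := by
  have hx' : square e a ∈ h.star v := hx ▸ hγ ⟨0, γ.source⟩
  have hy' : square e' a' ∈ h.star v := hy ▸ hγ ⟨1, γ.target⟩
  obtain ⟨c, hκ, hc⟩ := h.square_mem_star.1 hx'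
  obtain ⟨c', hκ', hc'⟩ := h.square_mem_star.1 hy'
  refine ⟨c, c', hc, hc', Path.Homotopic.Quotient.mk_eq_of_contraction (H := h.contraction)
    (h.continuous_contraction v) ?_ ?_ hγ
    (α := ((squareLine a c).map (square e).continuous).cast hx.symm hc.symm) ?_
    (β := ((squareLine a' c').map (square e').continuous).cast hy.symm hc'.symm) ?_⟩
  · rintro ⟨e, a⟩ hz
    obtain ⟨c, hκ, hc⟩ := h.square_mem_star.1 hz
    exact (h.contraction_square hκ 0).trans (by simp; rfl)
  · rintro ⟨e, a⟩ hz
    obtain ⟨c, hκ, hc⟩ := h.square_mem_star.1 hz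
    exact (h.contraction_square hκ 1).trans (by simpa using hc)
  · intro t
    subst hx
    rw [h.contraction_square hκ]
    rfl
  · intro t
    subst hy
    rw [h.contraction_square hκ']
    rfl

end IsStar

end BipartiteRotationSystem

namespace Path.Homotopic.Quotient

theorem symm_of_trans {X : Type*} [TopologicalSpace X] {x y z : X}
    (γ : Path.Homotopic.Quotient x y) (δ : Path.Homotopic.Quotient y z) :
    (γ.trans δ).symm = δ.symm.trans γ.symm := by
  obtain ⟨γ⟩ := γ
  obtain ⟨δ⟩ := δ
  exact congrArg mk (Path.trans_symm γ δ)

theorem symm_of_symm {X : Type*} [TopologicalSpace X] {x y : X}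
    (γ : Path.Homotopic.Quotient x y) : γ.symm.symm = γ := by
  obtain ⟨γ⟩ := γ
  exact congrArg mk (Path.symm_symm γ)

theorem symm_refl {X : Type*} [TopologicalSpace X] (x : X) : (refl x).symm = refl x :=
  congrArg mk Path.refl_symm

end Path.Homotopic.Quotient

namespace BipartiteRotationSystem

open Set Topology

variable {Δ : BipartiteRotationSystem}

/-! ### The stars of the vertices and of the centres of the tiles -/

open Classical in
/-- In the stars of the white vertices, the corner is the white vertex. -/
def whiteCorner (_ : Δ.Edge) (a : unitInterval × unitInterval) :
    Option (unitInterval × unitInterval) :=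
  if a.1 < 1 ∧ a.2 < 1 then some (0, 0) else none

open Classical in
/-- In the stars of the black vertices, the corner is the black vertex. -/
def blackCorner (_ : Δ.Edge) (a : unitInterval × unitInterval) :
    Option (unitInterval × unitInterval) :=
  if 0 < a.1 ∧ 0 < a.2 then some (1, 1) else none

open Classical in
/-- In the tiles, the corner is the centre of the tile. -/
def tileCorner (_ : Δ.Edge) (a : unitInterval × unitInterval) :
    Option (unitInterval × unitInterval) :=
  if a.2 < a.1 then some (1, 0) else if a.1 < a.2 then some (0, 1) else none

/-- The sides glued by `τ` are removed, and `σ` glues the remaining sides so that segments towards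
the white corner correspond. -/
theorem isStar_whiteCorner : IsStar (whiteCorner (Δ := Δ)) where
  isOpen e c := by
    by_cases hc : c = (0, 0)
    · subst hc
      have : {a | whiteCorner e a = some (0, 0)} =
          {a : unitInterval × unitInterval | a.1 < 1} ∩ {a | a.2 < 1} := by
        ext a; simp [whiteCorner]
      rw [this]
      exact (isOpen_lt (by fun_prop) (by fun_prop)).inter (isOpen_lt (by fun_prop) (by fun_prop))
    · convert isOpen_empty
      ext a
      simp [whiteCorner, Ne.symm hc]
  isSome_iff z z' h := by
    rcases h with ⟨e, t⟩ | ⟨e, t⟩ <;> simp [whiteCorner]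
  motion_eq z z' h r := by
    rcases h with ⟨e, t⟩ | ⟨e, t⟩
    · by_cases ht : t < 1
      · simpa [starMotion, whiteCorner, ht, squareLine] using square_white e _
      · simpa [starMotion, whiteCorner, ht] using square_white e t
    · simpa [starMotion, whiteCorner] using square_black e t

theorem isStar_blackCorner : IsStar (blackCorner (Δ := Δ)) where
  isOpen e c := by
    by_cases hc : c = (1, 1)
    · subst hc
      have : {a | blackCorner e a = some (1, 1)} =
          {a : unitInterval × unitInterval | 0 < a.1} ∩ {a | 0 < a.2} := by
        ext a; simp [blackCorner]
      rw [this]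
      exact (isOpen_lt (by fun_prop) (by fun_prop)).inter (isOpen_lt (by fun_prop) (by fun_prop))
    · convert isOpen_empty
      ext a
      simp [blackCorner, Ne.symm hc]
  isSome_iff z z' h := by
    rcases h with ⟨e, t⟩ | ⟨e, t⟩ <;> simp [blackCorner]
  motion_eq z z' h r := by
    rcases h with ⟨e, t⟩ | ⟨e, t⟩
    · simpa [starMotion, blackCorner] using square_white e t
    · by_cases ht : 0 < t
      · simpa [starMotion, blackCorner, ht, squareLine] using square_black e _
      · simpa [starMotion, blackCorner, ht] using square_black e t

/-- Removing the diagonals removes the graph. Both kinds of gluing match a side in the left half of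
a square with a side in the right half, and match the corresponding tile centres. -/
theorem isStar_tileCorner : IsStar (tileCorner (Δ := Δ)) where
  isOpen e c := by
    by_cases hc : c = (1, 0)
    · subst hc
      have : {a | tileCorner e a = some (1, 0)} =
          {a : unitInterval × unitInterval | a.2 < a.1} := by
        ext a
        by_cases h : a.2 < a.1 <;> simp [tileCorner, h]
      rw [this]
      exact isOpen_lt (by fun_prop) (by fun_prop)
    · by_cases hc' : c = (0, 1)
      · subst hc'
        have : {a | tileCorner e a = some (0, 1)} =
            {a : unitInterval × unitInterval | a.1 < a.2} := by
          ext a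
          by_cases h : a.2 < a.1
          · simp [tileCorner, h, h.le]
          · simp [tileCorner, h]
        rw [this]
        exact isOpen_lt (by fun_prop) (by fun_prop)
      · convert isOpen_empty
        ext a
        simp only [mem_empty_iff_false, iff_false]
        change ¬ tileCorner e a = some c
        unfold tileCorner
        split_ifs <;> simp [Ne.symm hc, Ne.symm hc']
  isSome_iff z z' h := by
    rcases h with ⟨e, t⟩ | ⟨e, t⟩
    · by_cases ht : 0 < t <;> simp [tileCorner, ht]
    · have h1 : ¬ 1 < t := not_lt.2 unitInterval.le_one'
      by_cases ht : t < 1 <;> simp [tileCorner, ht, h1]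
  motion_eq z z' h r := by
    rcases h with ⟨e, t⟩ | ⟨e, t⟩
    · by_cases ht : 0 < t
      · simpa [starMotion, tileCorner, ht, squareLine] using square_white e _
      · simpa [starMotion, tileCorner, ht] using square_white e t
    · have h1 : ¬ 1 < t := not_lt.2 unitInterval.le_one'
      by_cases ht : t < 1
      · simpa [starMotion, tileCorner, ht, squareLine, h1] using square_black e _
      · simpa [starMotion, tileCorner, ht, h1] using square_black e t

variable (Δ) in
/-- The cover of the realization by the stars. -/
def starCover : Fin 3 × Δ.Realization → Set Δ.Realization
  | (0, v) => isStar_whiteCorner.star v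
  | (1, v) => isStar_blackCorner.star v
  | (2, v) => isStar_tileCorner.star v

theorem isOpen_starCover (i : Fin 3 × Δ.Realization) : IsOpen (Δ.starCover i) := by
  obtain ⟨i, v⟩ := i
  fin_cases i
  · exact isStar_whiteCorner.isOpen_star v
  · exact isStar_blackCorner.isOpen_star v
  · exact isStar_tileCorner.isOpen_star v

/-- The white and black stars together miss only the corners `(1,0)` and `(0,1)` of the squares,
which are the tile centres. -/
theorem exists_mem_starCover (x : Δ.Realization) : ∃ i, x ∈ Δ.starCover i := by
  obtain ⟨⟨e, a⟩⟩ := x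
  by_cases h1 : a.1 < 1 ∧ a.2 < 1
  · exact ⟨(0, square e (0, 0)), isStar_whiteCorner.square_mem_star.2
      ⟨(0, 0), by simp [whiteCorner, h1], rfl⟩⟩
  by_cases h2 : 0 < a.1 ∧ 0 < a.2
  · exact ⟨(1, square e (1, 1)), isStar_blackCorner.square_mem_star.2
      ⟨(1, 1), by simp [blackCorner, h2], rfl⟩⟩
  by_cases h3 : a.2 < a.1
  · exact ⟨(2, square e (1, 0)), isStar_tileCorner.square_mem_star.2
      ⟨(1, 0), by simp [tileCorner, h3], rfl⟩⟩
  by_cases h4 : a.1 < a.2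
  · exact ⟨(2, square e (0, 1)), isStar_tileCorner.square_mem_star.2
      ⟨(0, 1), by simp [tileCorner, h3, h4], rfl⟩⟩
  · have h5 : a.1 = a.2 := le_antisymm (not_lt.1 h3) (not_lt.1 h4)
    simp only [h5, and_self, not_lt] at h1 h2
    exact absurd (h1.trans h2) (not_le.2 zero_lt_one)

/-! ### Loops in the realization -/

theorem fromPath_mul {X : Type*} [TopologicalSpace X] {x : X}
    (γ δ : Path.Homotopic.Quotient x x) :
    FundamentalGroup.fromPath γ * FundamentalGroup.fromPath δ =
      FundamentalGroup.fromPath (δ.trans γ) := rfl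

theorem fromPath_inv {X : Type*} [TopologicalSpace X] {x : X} (γ : Path.Homotopic.Quotient x x) :
    (FundamentalGroup.fromPath γ)⁻¹ = FundamentalGroup.fromPath γ.symm := rfl

/-- The centre of a tile. -/
def center : Δ.Tile → Δ.Realization :=
  Quotient.lift (fun e => square e (0, 1)) fun _ _ h =>
    eq_of_sameCycle (F := fun e => square e (0, 1))
      (fun e => ((square_white e 1).trans (square_black (Δ.σ e) 0)).symm) h

theorem square_left (e : Δ.Edge) : square e (0, 1) = center (leftTile e) := rfl

theorem square_right (e : Δ.Edge) : square e (1, 0) = center (rightTile e) := square_black e 0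

/-- The homotopy class of paths given by a path of the dual quiver with inverse arrows added. -/
def pathClass {i : Quiver.Symmetrify Δ.Tile} : ∀ {j : Quiver.Symmetrify Δ.Tile}, Quiver.Path i j →
    Path.Homotopic.Quotient (center i) (center j)
  | _, .nil => .refl _
  | _, .cons q (Sum.inl a) => (pathClass q).trans (lineClass a.1 (1, 0) (0, 1)
      ((square_right a.1).trans (congrArg center a.2.1))
      ((square_left a.1).trans (congrArg center a.2.2)))
  | _, .cons q (Sum.inr a) => (pathClass q).trans (lineClass a.1 (0, 1) (1, 0)
      ((square_left a.1).trans (congrArg center a.2.2))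
      ((square_right a.1).trans (congrArg center a.2.1)))

section Loops

variable {x₀ : Δ.Realization} (B : ∀ i : Δ.Tile, Path.Homotopic.Quotient x₀ (center i))

/-- The loop that goes to the tile to the right of an edge, crosses the edge, and goes back from the
tile to the left of the edge. -/
def loop (e : Δ.Edge) : FundamentalGroup Δ.Realization x₀ :=
  .fromPath (((B (rightTile e)).trans
    (lineClass e (1, 0) (0, 1) (square_right e) (square_left e))).trans (B (leftTile e)).symm)

theorem holonomy_loop {i j : Quiver.Symmetrify Δ.Tile} (q : Quiver.Path i j) :
    holonomy (loop B) q = .fromPath (((B i).trans (pathClass q)).trans (B j).symm) := by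
  induction q with
  | nil =>
    rw [holonomy_nil, pathClass, Path.Homotopic.Quotient.trans_refl,
      Path.Homotopic.Quotient.trans_symm]
    rfl
  | cons q a ih =>
    rcases a with ⟨a, rfl, rfl⟩ | ⟨a, rfl, rfl⟩
    · simp only [holonomy, ih]
      rw [loop, fromPath_mul]
      simp only [pathClass, Path.Homotopic.Quotient.trans_assoc]
      rw [← Path.Homotopic.Quotient.trans_assoc (B _).symm, Path.Homotopic.Quotient.symm_trans,
        Path.Homotopic.Quotient.refl_trans]
    · simp only [holonomy, ih]
      rw [loop, fromPath_inv, fromPath_mul]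
      simp only [pathClass, Path.Homotopic.Quotient.trans_assoc,
        Path.Homotopic.Quotient.symm_of_trans, Path.Homotopic.Quotient.symm_of_symm, lineClass_symm]
      rw [← Path.Homotopic.Quotient.trans_assoc (B _).symm, Path.Homotopic.Quotient.symm_trans,
        Path.Homotopic.Quotient.refl_trans]

/-- The path class from the base point to a point of a square, through the tile to the right. -/
def reference (e : Δ.Edge) (a : unitInterval × unitInterval) {x : Δ.Realization}
    (hx : square e a = x) : Path.Homotopic.Quotient x₀ x :=
  (B (rightTile e)).trans (lineClass e (1, 0) a (square_right e) hx)

theorem reference_eq {e : Δ.Edge} {a : unitInterval × unitInterval} {x : Δ.Realization}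
    (hx : square e a = x) {i : Δ.Tile} (hi : rightTile e = i) (hi' : square e (1, 0) = center i) :
    reference B e a hx = (B i).trans (lineClass e (1, 0) a hi' hx) := by
  subst hi
  rfl

theorem reference_trans {e : Δ.Edge} {a b : unitInterval × unitInterval} {x y : Δ.Realization}
    (hx : square e a = x) (hy : square e b = y) :
    (reference B e a hx).trans (lineClass e a b hx hy) = reference B e b hy := by
  rw [reference, Path.Homotopic.Quotient.trans_assoc, lineClass_trans]
  rfl

/-- The side from the left tile centre to the glued point is common to the squares of `e` and `σ e`.
The two references thus share their last segment and differ by one crossing of `e`. -/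
theorem reference_white (e : Δ.Edge) (t : unitInterval) {x : Δ.Realization}
    (hx : square e (0, t) = x) (hx' : square (Δ.σ e) (t, 0) = x) :
    (reference B e (0, t) hx).trans (reference B (Δ.σ e) (t, 0) hx').symm = loop B e := by
  rw [← reference_trans B (square_left e) hx, lineClass_white,
    reference_eq B hx' (leftTile_eq_rightTile_σ e).symm
      ((square_white e 1).symm.trans (square_left e)),
    Path.Homotopic.Quotient.symm_of_trans, Path.Homotopic.Quotient.trans_assoc,
    ← Path.Homotopic.Quotient.trans_assoc (lineClass _ _ _ _ _),
    Path.Homotopic.Quotient.trans_symm, Path.Homotopic.Quotient.refl_trans]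
  rfl

/-- Here the common tile is to the right of `e` and to the left of `τ e`, so the difference is a
crossing of `τ e` in the reverse direction. -/
theorem reference_black (e : Δ.Edge) (t : unitInterval) {x : Δ.Realization}
    (hx : square e (1, t) = x) (hx' : square (Δ.τ e) (t, 1) = x) :
    (reference B e (1, t) hx).trans (reference B (Δ.τ e) (t, 1) hx').symm =
      (loop B (Δ.τ e))⁻¹ := by
  have h : square e (1, 0) = center (leftTile (Δ.τ e)) := square_right e
  change ((B (leftTile (Δ.τ e))).trans (lineClass e (1, 0) (1, t) h hx)).trans _ = _
  rw [← reference_trans B (square_left (Δ.τ e)) hx', lineClass_black,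
    Path.Homotopic.Quotient.symm_of_trans, Path.Homotopic.Quotient.trans_assoc,
    ← Path.Homotopic.Quotient.trans_assoc (lineClass _ _ _ _ _),
    Path.Homotopic.Quotient.trans_symm, Path.Homotopic.Quotient.refl_trans, loop, fromPath_inv,
    Path.Homotopic.Quotient.symm_of_trans _ (B (leftTile (Δ.τ e))).symm,
    Path.Homotopic.Quotient.symm_of_symm]
  rfl

/-- The differences of references to the same point lie in any subgroup that contains all the
loops. -/
theorem reference_mem {H : Subgroup (FundamentalGroup Δ.Realization x₀)} (hH : ∀ e, loop B e ∈ H)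
    {e e' : Δ.Edge} {a a' : unitInterval × unitInterval} {x : Δ.Realization}
    (hx : square e a = x) (hx' : square e' a' = x) :
    FundamentalGroup.fromPath ((reference B e a hx).trans (reference B e' a' hx').symm) ∈ H := by
  -- Two representatives of a point are linked by finitely many gluings, each contributing a loop or
  -- its inverse.
  suffices h : ∀ z z', Relation.EqvGen Δ.GluingRel z z' → ∀ (x : Δ.Realization)
      (hx : square z.1 z.2 = x) (hx' : square z'.1 z'.2 = x), FundamentalGroup.fromPath
        ((reference B z.1 z.2 hx).trans (reference B z'.1 z'.2 hx').symm) ∈ H from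
    h ⟨e, a⟩ ⟨e', a'⟩ (Quot.eqvGen_exact (hx.trans hx'.symm)) x hx hx'
  intro z z' h
  induction h with
  | rel z z' h =>
    intro x hx hx'
    rcases h with ⟨e, t⟩ | ⟨e, t⟩
    · rw [reference_white B e t hx hx']
      exact hH e
    · rw [reference_black B e t hx hx']
      exact H.inv_mem (hH _)
  | refl z =>
    intro x hx hx'
    rw [Path.Homotopic.Quotient.trans_symm]
    exact H.one_mem
  | symm z z' _ ih =>
    intro x hx hx'
    have h1 := H.inv_mem (ih x hx' hx)
    rw [fromPath_inv, Path.Homotopic.Quotient.symm_of_trans,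
      Path.Homotopic.Quotient.symm_of_symm] at h1
    exact h1
  | trans z z' z'' h h' ih ih' =>
    intro x hx hx'
    have hx'' : square z'.1 z'.2 = x := (Quot.eqvGen_sound h).symm.trans hx
    have h1 := H.mul_mem (ih' x hx'' hx') (ih x hx hx'')
    rw [fromPath_mul, Path.Homotopic.Quotient.trans_assoc,
      ← Path.Homotopic.Quotient.trans_assoc (Path.Homotopic.Quotient.symm _),
      Path.Homotopic.Quotient.symm_trans, Path.Homotopic.Quotient.refl_trans] at h1
    exact h1

/-- The loops around the edges generate the fundamental group. -/
theorem closure_loop_eq_top {i₀ : Δ.Tile}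
    (B : ∀ i : Δ.Tile, Path.Homotopic.Quotient (center i₀) (center i)) (hB : B i₀ = .refl _) :
    Subgroup.closure (range (loop B)) = ⊤ := by
  set H := Subgroup.closure (range (loop B))
  have hH : ∀ e, loop B e ∈ H := fun e => Subgroup.subset_closure ⟨e, rfl⟩
  -- The property makes sense for paths that are not closed: they are closed up by references, with
  -- all choices of representatives of the endpoints allowed so that it is stable under composition.
  let S : ∀ {x y : Δ.Realization}, Path.Homotopic.Quotient x y → Prop := fun {x y} γ =>
    ∀ e a e' a' (hx : square e a = x) (hy : square e' a' = y), FundamentalGroup.fromPath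
      (((reference B e a hx).trans γ).trans (reference B e' a' hy).symm) ∈ H
  have hS : ∀ {x y : Δ.Realization} (γ : Path.Homotopic.Quotient x y), S γ := by
    refine Path.Homotopic.Quotient.induction_of_open_cover isOpen_starCover exists_mem_starCover
      (S := S) ?_ ?_
    · intro x y z γ δ hγ hδ e a e' a' hx hz
      obtain ⟨⟨e₁, a₁⟩, hy⟩ := Quot.exists_rep y
      change square e₁ a₁ = y at hy
      have h1 := H.mul_mem (hδ e₁ a₁ e' a' hy hz) (hγ e a e₁ a₁ hx hy)
      rw [fromPath_mul] at h1
      convert h1 using 1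
      simp only [Path.Homotopic.Quotient.trans_assoc]
      rw [← Path.Homotopic.Quotient.trans_assoc (Path.Homotopic.Quotient.symm _)
        (reference B _ _ _), Path.Homotopic.Quotient.symm_trans,
        Path.Homotopic.Quotient.refl_trans]
    -- For a path in one star, the references extend along the segments to the centre, and what
    -- remains is the difference of two references to that centre.
    · rintro ⟨i, v⟩ x y γ hγ e a e' a' hx hy
      obtain ⟨c, c', hc, hc', h⟩ : ∃ c c', ∃ (hc : square e c = v) (hc' : square e' c' = v),
          Path.Homotopic.Quotient.mk γ =
            (lineClass e a c hx hc).trans (lineClass e' a' c' hy hc').symm := by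
        fin_cases i
        · exact isStar_whiteCorner.mk_eq hγ hx hy
        · exact isStar_blackCorner.mk_eq hγ hx hy
        · exact isStar_tileCorner.mk_eq hγ hx hy
      have h1 := reference_mem B hH hc hc'
      rw [h, ← Path.Homotopic.Quotient.trans_assoc, reference_trans,
        Path.Homotopic.Quotient.trans_assoc, ← Path.Homotopic.Quotient.symm_of_trans,
        reference_trans]
      exact h1
  refine (Subgroup.eq_top_iff' H).2 fun γ => ?_
  obtain ⟨e, he⟩ := exists_rightTile_eq i₀
  have hc : square e (1, 0) = center i₀ := (square_right e).trans (congrArg center he)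
  have h1 := hS (FundamentalGroup.toPath γ) e (1, 0) e (1, 0) hc hc
  rw [reference_eq B hc he hc, lineClass_self, hB, Path.Homotopic.Quotient.refl_trans,
    Path.Homotopic.Quotient.symm_refl, Path.Homotopic.Quotient.refl_trans,
    Path.Homotopic.Quotient.trans_refl] at h1
  exact h1

/-- Going to the corner through the square of `e` and returning along a path fixed for the vertex
gives a potential for the loops, so their product around the vertex telescopes to one. -/
theorem cycleProd_loop_of_corner {V : Type*} {f : Δ.Edge → V} {v : V → Δ.Realization}
    {c : unitInterval × unitInterval} (hv : ∀ e, square e c = v (f e))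
    (A : ∀ w, Path.Homotopic.Quotient x₀ (v w)) {ρ : Equiv.Perm Δ.Edge} (hf : ∀ e, f (ρ e) = f e)
    (h : ∀ e (x : Δ.Realization) (hx : square (ρ e) c = x) (hx' : square e c = x),
      FundamentalGroup.fromPath ((reference B (ρ e) c hx).trans (reference B e c hx').symm) =
        (loop B e)⁻¹) (e : Δ.Edge) : cycleProd (loop B) ρ e = 1 := by
  refine cycleProd_eq_one_of_potential (u := fun e => FundamentalGroup.fromPath
    ((reference B e c (hv e)).trans (A (f e)).symm)) (fun e => ?_) e
  have hu : ∀ e w (_ : f e = w) (hw : square e c = v w),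
      (reference B e c (hv e)).trans (A (f e)).symm = (reference B e c hw).trans (A w).symm := by
    rintro e _ rfl hw
    rfl
  have hw : square (ρ e) c = v (f e) := by rw [← hf, hv]
  rw [← h e (v (f e)) hw (hv e), fromPath_mul, hu (ρ e) (f e) (hf e) hw,
    Path.Homotopic.Quotient.trans_assoc,
    ← Path.Homotopic.Quotient.trans_assoc _ (reference B _ _ _),
    Path.Homotopic.Quotient.symm_trans, Path.Homotopic.Quotient.refl_trans]

theorem cycleProd_loop_σ (e : Δ.Edge) : cycleProd (loop B) Δ.σ e = 1 := by
  let v : Δ.White → Δ.Realization := Quotient.lift (fun e => square e (0, 0)) fun _ _ h =>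
    eq_of_sameCycle (F := fun e => square e (0, 0)) (fun e => (square_white e 0).symm) h
  refine cycleProd_loop_of_corner B (f := white) (v := v) (c := (0, 0)) (fun e => rfl)
    (fun w => reference B (Quotient.out w) (0, 0) (congrArg v (Quotient.out_eq w))) white_σ
    (fun e x hx hx' => ?_) e
  rw [← reference_white B e 0 hx' hx, fromPath_inv, Path.Homotopic.Quotient.symm_of_trans,
    Path.Homotopic.Quotient.symm_of_symm]

theorem black_τ_symm (e : Δ.Edge) : black (Δ.τ.symm e) = black e := by
  rw [← black_τ, Equiv.apply_symm_apply]

theorem cycleProd_loop_τ_symm (e : Δ.Edge) : cycleProd (loop B) Δ.τ.symm e = 1 := by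
  let v : Δ.Black → Δ.Realization := Quotient.lift (fun e => square e (1, 1)) fun _ _ h =>
    eq_of_sameCycle (F := fun e => square e (1, 1)) (fun e => (square_black e 1).symm) h
  refine cycleProd_loop_of_corner B (f := black) (v := v) (c := (1, 1)) (fun e => rfl)
    (fun w => reference B (Quotient.out w) (1, 1) (congrArg v (Quotient.out_eq w))) black_τ_symm
    (fun e x hx hx' => ?_) e
  obtain ⟨e, rfl⟩ := Δ.τ.surjective e
  simp only [Equiv.symm_apply_apply] at hx ⊢
  exact reference_black B e 1 hx hx'

end Loops

/-! ### From the combinatorial to the topological fundamental group: surjectivity -/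

section LoopHom

variable {i₀ : Quiver.Symmetrify Δ.Tile} {p : ∀ i : Quiver.Symmetrify Δ.Tile, Quiver.Path i₀ i}

/-- The homomorphism from the combinatorial to the topological fundamental group. -/
def loopHom (hp : p i₀ = Quiver.Path.nil) :
    SurfaceGroup p →* FundamentalGroup Δ.Realization (center i₀) :=
  SurfaceGroup.lift (loop fun i => pathClass (p i)) (cycleProd_loop_σ _) (cycleProd_loop_τ_symm _)
    (fun i => by
      rw [holonomy_loop, hp, pathClass, Path.Homotopic.Quotient.refl_trans,
        Path.Homotopic.Quotient.trans_symm]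
      rfl)

theorem loopHom_of (hp : p i₀ = Quiver.Path.nil) (e : Δ.Edge) :
    loopHom hp (PresentedGroup.of e) = loop (fun i => pathClass (p i)) e :=
  SurfaceGroup.lift_of _ _ _ _ e

theorem loopHom_surjective (hp : p i₀ = Quiver.Path.nil) : Function.Surjective (loopHom hp) := by
  rw [← MonoidHom.range_eq_top, eq_top_iff,
    ← closure_loop_eq_top (fun i => pathClass (p i)) (by rw [hp, pathClass]), Subgroup.closure_le]
  rintro _ ⟨e, rfl⟩
  exact ⟨_, loopHom_of hp e⟩

end LoopHom

/-- The squares of a set of edges invariant under both rotations form a clopen subset of the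
realization. -/
theorem isTransitive_of_connectedSpace [ConnectedSpace Δ.Realization] : Δ.IsTransitive := by
  intro S ⟨e₀, he₀⟩ hσ hτ e
  let f : Δ.Realization → Prop := Quot.lift (fun z => z.1 ∈ S) (by
    rintro _ _ (⟨e, t⟩ | ⟨e, t⟩)
    · exact propext (hσ e).symm
    · exact propext (hτ e).symm)
  have hopen : ∀ q : Prop, IsOpen {x | f x = q} := fun q => by
    rw [← isQuotientMap_quot_mk.isOpen_preimage, isOpen_sigma_iff]
    intro e
    change IsOpen {_a : unitInterval × unitInterval | (e ∈ S) = q}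
    exact isOpen_const
  have hclopen : IsClopen {x | f x = True} := by
    refine ⟨⟨?_⟩, hopen True⟩
    convert hopen False using 1
    ext x
    by_cases h : f x <;> simp [h]
  have huniv : {x | f x = True} = univ := hclopen.eq_univ ⟨square e₀ (0, 0), eq_true he₀⟩
  have : square e (0, 0) ∈ {x | f x = True} := huniv ▸ mem_univ _
  exact of_eq_true this

end BipartiteRotationSystem

namespace BipartiteRotationSystem

open Set Topology

variable {Δ : BipartiteRotationSystem} {K : Type} [Group K]

/-! ### The covering space of a group-valued function on the edges -/

/-- The gluing of copies of the squares, indexed by a group, in which crossing the edge `e` changes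
the index by `φ e`. -/
inductive CoverRel (φ : Δ.Edge → K) : (Σ _ : Δ.Edge × K, unitInterval × unitInterval) →
    (Σ _ : Δ.Edge × K, unitInterval × unitInterval) → Prop
  | white (e : Δ.Edge) (k : K) (t : unitInterval) :
      CoverRel φ ⟨(e, k), (0, t)⟩ ⟨(Δ.σ e, k * (φ e)⁻¹), (t, 0)⟩
  | black (e : Δ.Edge) (k : K) (t : unitInterval) :
      CoverRel φ ⟨(e, k), (1, t)⟩ ⟨(Δ.τ e, k * φ (Δ.τ e)), (t, 1)⟩

/-- The covering space of the realization given by a function on the edges. -/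
def Cover (φ : Δ.Edge → K) := Quot (CoverRel φ)

namespace Cover

variable (φ : Δ.Edge → K)

instance : TopologicalSpace (Cover φ) := inferInstanceAs (TopologicalSpace (Quot _))

/-- The squares of the covering space. -/
def square (e : Δ.Edge) (k : K) : C(unitInterval × unitInterval, Cover φ) :=
  ⟨fun a => Quot.mk _ ⟨(e, k), a⟩, continuous_quot_mk.comp
    (continuous_sigmaMk (σ := fun _ : Δ.Edge × K => unitInterval × unitInterval))⟩

variable {φ}

theorem square_white (e : Δ.Edge) (k : K) (t : unitInterval) :
    square φ e k (0, t) = square φ (Δ.σ e) (k * (φ e)⁻¹) (t, 0) :=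
  Quot.sound (.white e k t)

theorem square_black (e : Δ.Edge) (k : K) (t : unitInterval) :
    square φ e k (1, t) = square φ (Δ.τ e) (k * φ (Δ.τ e)) (t, 1) :=
  Quot.sound (.black e k t)

theorem exists_square (x : Cover φ) : ∃ e k a, square φ e k a = x := by
  obtain ⟨⟨⟨e, k⟩, a⟩⟩ := x
  exact ⟨e, k, a, rfl⟩

instance : MulAction K (Cover φ) where
  smul g := Quot.map (fun z => ⟨(z.1.1, g * z.1.2), z.2⟩) (by
    rintro _ _ (⟨e, k, t⟩ | ⟨e, k, t⟩)
    · rw [← mul_assoc]; exact .white e (g * k) t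
    · rw [← mul_assoc]; exact .black e (g * k) t)
  one_smul x := by
    obtain ⟨e, k, a, rfl⟩ := exists_square x
    change square φ e (1 * k) a = _
    rw [one_mul]
  mul_smul g h x := by
    obtain ⟨e, k, a, rfl⟩ := exists_square x
    change square φ e (g * h * k) a = square φ e (g * (h * k)) a
    rw [mul_assoc]

theorem smul_square (g : K) (e : Δ.Edge) (k : K) (a : unitInterval × unitInterval) :
    g • square φ e k a = square φ e (g * k) a := rfl

variable (φ) in
/-- The projection of the covering space. -/
def proj : Cover φ → Δ.Realization :=
  Quot.map (fun z => ⟨z.1.1, z.2⟩) (by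
    rintro _ _ (⟨e, k, t⟩ | ⟨e, k, t⟩)
    · exact .white e t
    · exact .black e t)

theorem continuous_iff {Y : Type*} [TopologicalSpace Y] {f : Cover φ → Y} :
    Continuous f ↔ ∀ e k, Continuous fun a => f (square φ e k a) := by
  have hq : IsQuotientMap (Quot.mk (CoverRel φ)) := isQuotientMap_quot_mk
  refine hq.continuous_iff.trans (continuous_sigma_iff.trans ?_)
  exact ⟨fun h e k => h (e, k), fun h i => h i.1 i.2⟩

theorem isOpen_iff {U : Set (Cover φ)} :
    IsOpen U ↔ ∀ e k, IsOpen {a | square φ e k a ∈ U} := by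
  have hq : IsQuotientMap (Quot.mk (CoverRel φ)) := isQuotientMap_quot_mk
  refine hq.isOpen_preimage.symm.trans (isOpen_sigma_iff.trans ?_)
  exact ⟨fun h e k => h (e, k), fun h i => h i.1 i.2⟩

instance : ContinuousConstSMul K (Cover φ) where
  continuous_const_smul g := continuous_iff.2 fun e k => (square φ e (g * k)).continuous

theorem continuous_proj : Continuous (proj φ) :=
  continuous_iff.2 fun e _ => (BipartiteRotationSystem.square e).continuous

theorem isQuotientMap_proj : IsQuotientMap (proj φ) := by
  let s : (Σ _ : Δ.Edge, unitInterval × unitInterval) → Cover φ := fun z => square φ z.1 1 z.2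
  have hs : Continuous s := continuous_sigma fun e => (square φ e 1).continuous
  have h : proj φ ∘ s = Quot.mk _ := rfl
  exact IsQuotientMap.of_comp hs continuous_proj (h ▸ isQuotientMap_quot_mk)

/-- Sending a point to the orbit of its copy of index 1 is compatible with the gluing, because the
gluings change the index only within an orbit. This recovers the orbit from the projection. -/
theorem proj_eq_iff {x y : Cover φ} : proj φ x = proj φ y ↔ x ∈ MulAction.orbit K y := by
  constructor
  · intro h
    let s : Δ.Realization → MulAction.orbitRel.Quotient K (Cover φ) :=
      Quot.lift (fun z => Quotient.mk _ (square φ z.1 1 z.2)) (by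
        rintro _ _ (⟨e, t⟩ | ⟨e, t⟩)
        · refine Quotient.sound ⟨(φ e)⁻¹, ?_⟩
          simp only [smul_square, mul_one]
          rw [square_white, one_mul]
        · refine Quotient.sound ⟨φ (Δ.τ e), ?_⟩
          simp only [smul_square, mul_one]
          rw [square_black, one_mul])
    have hs : ∀ x, s (proj φ x) = Quotient.mk _ x := fun x => by
      obtain ⟨e, k, a, rfl⟩ := exists_square x
      refine Quotient.sound ⟨k⁻¹, ?_⟩
      simp only [smul_square, inv_mul_cancel]
    have h1 := congrArg s h
    rw [hs, hs] at h1
    exact Quotient.exact h1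
  · rintro ⟨g, rfl⟩
    obtain ⟨e, k, a, rfl⟩ := exists_square y
    rfl

/-- An open set on which a function to the group is defined, up to its being equivariant and
compatible with the gluing. -/
structure IsChart (P : Δ.Edge → unitInterval × unitInterval → K → Prop) : Prop where
  isOpen : ∀ e g, IsOpen {a | P e a g}
  white : ∀ e t g, P e (0, t) g ↔ P (Δ.σ e) (t, 0) (φ e * g)
  black : ∀ e t g, P e (1, t) g ↔ P (Δ.τ e) (t, 1) ((φ (Δ.τ e))⁻¹ * g)
  unique : ∀ e a g g', P e a g → P e a g' → g = g'

/-- The relation `P` is the graph of a partial function `g`. The map from `(e, k, a)` to `k * g`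
descends to an equivariant map to the group on an invariant open set, and distinct translates of a
level set are disjoint. -/
theorem IsChart.disjoint {P : Δ.Edge → unitInterval × unitInterval → K → Prop}
    (hP : IsChart (φ := φ) P) {e : Δ.Edge} {k : K} {a : unitInterval × unitInterval} {g : K}
    (hg : P e a g) :
    ∃ U ∈ 𝓝 (square φ e k a), ∀ g : K, ((g • ·) '' U ∩ U).Nonempty → g = 1 := by
  let F : Cover φ → Prop := Quot.lift (fun z => P z.1.1 z.2 (z.1.2⁻¹ * (k * g))) (by
    rintro _ _ (⟨e, k', t⟩ | ⟨e, k', t⟩)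
    · refine propext ((hP.white _ _ _).trans ?_)
      simp [mul_assoc]
    · refine propext ((hP.black _ _ _).trans ?_)
      simp [mul_assoc])
  have hF : ∀ e' k' a', F (square φ e' k' a') = P e' a' (k'⁻¹ * (k * g)) := fun _ _ _ => rfl
  refine ⟨{x | F x}, IsOpen.mem_nhds
    (isOpen_iff.2 fun e' k' => hP.isOpen e' (k'⁻¹ * (k * g))) ?_, ?_⟩
  · change F (square φ e k a)
    rw [hF]
    simpa using hg
  · rintro h ⟨_, ⟨x, hx, rfl⟩, hx'⟩
    obtain ⟨e', k', a', rfl⟩ := exists_square x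
    change F (square φ e' k' a') at hx
    change F (h • square φ e' k' a') at hx'
    rw [smul_square, hF] at hx'
    rw [hF] at hx
    have := hP.unique _ _ _ _ hx hx'
    simp only [mul_inv_rev, mul_left_inj] at this
    simpa using this

/-- Charts are needed over the three kinds of stars. Over the vertex stars they are inverse
potentials of `φ` along `σ` and `τ⁻¹`, which exist because the cycle products are trivial. -/
theorem isQuotientCoveringMap_proj (hσ : ∀ e, cycleProd φ Δ.σ e = 1)
    (hτ : ∀ e, cycleProd φ Δ.τ.symm e = 1) : IsQuotientCoveringMap (proj φ) K where
  __ := isQuotientMap_proj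
  __ := (inferInstance : ContinuousConstSMul K (Cover φ))
  apply_eq_iff_mem_orbit := proj_eq_iff
  disjoint x := by
    obtain ⟨e, k, a, rfl⟩ := exists_square x
    obtain ⟨u, hu⟩ := exists_potential hσ
    obtain ⟨v, hv⟩ := exists_potential hτ
    have hv' : ∀ e, v e = v (Δ.τ e) * (φ (Δ.τ e))⁻¹ := fun e => by
      rw [← hv, Equiv.symm_apply_apply]
    by_cases h1 : a.1 < 1 ∧ a.2 < 1
    · refine IsChart.disjoint (P := fun e a g => (a.1 < 1 ∧ a.2 < 1) ∧ g = (u e)⁻¹)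
        ⟨fun e g => ?_, fun e t g => ?_, fun e t g => ?_, fun e a g g' h h' => h.2.trans h'.2.symm⟩
        (e := e) (a := a) ⟨h1, rfl⟩
      · exact ((isOpen_lt (by fun_prop) (by fun_prop)).inter
          (isOpen_lt (by fun_prop) (by fun_prop))).inter isOpen_const
      · simp [hu]
      · simp
    by_cases h2 : 0 < a.1 ∧ 0 < a.2
    · refine IsChart.disjoint (P := fun e a g => (0 < a.1 ∧ 0 < a.2) ∧ g = (v e)⁻¹)
        ⟨fun e g => ?_, fun e t g => ?_, fun e t g => ?_, fun e a g g' h h' => h.2.trans h'.2.symm⟩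
        (e := e) (a := a) ⟨h2, rfl⟩
      · exact ((isOpen_lt (by fun_prop) (by fun_prop)).inter
          (isOpen_lt (by fun_prop) (by fun_prop))).inter isOpen_const
      · simp
      · simp [hv' e, inv_mul_eq_iff_eq_mul]
    · have h3 : a.2 < a.1 ∨ a.1 < a.2 := by
        by_contra! h
        have h5 : a.1 = a.2 := le_antisymm h.1 h.2
        simp only [h5, and_self, not_lt] at h1 h2
        exact absurd (h1.trans h2) (not_le.2 zero_lt_one)
      -- Over a tile, the chart is normalized by the right half of each square; the left half of the
      -- square of index `k` lies in sheet `k * (φ e)⁻¹`.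
      have hP : IsChart (φ := φ) 
          (fun e a g => (a.2 < a.1 ∧ g = 1) ∨ (a.1 < a.2 ∧ g = (φ e)⁻¹)) := by
        refine ⟨fun e g => ?_, fun e t g => ?_, fun e t g => ?_, fun e a g g' h h' => ?_⟩
        · exact ((isOpen_lt (by fun_prop) (by fun_prop)).inter isOpen_const).union
            ((isOpen_lt (by fun_prop) (by fun_prop)).inter isOpen_const)
        · have ht : ¬ t < 0 := not_lt.2 unitInterval.nonneg'
          simp [ht, mul_eq_one_iff_eq_inv']
        · have ht : ¬ 1 < t := not_lt.2 unitInterval.le_one'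
          simp [ht]
        · rcases h with h | h <;> rcases h' with h' | h'
          · rw [h.2, h'.2]
          · exact absurd h.1 h'.1.le.not_gt
          · exact absurd h.1 h'.1.le.not_gt
          · rw [h.2, h'.2]
      rcases h3 with h3 | h3
      · exact hP.disjoint (Or.inl ⟨h3, rfl⟩)
      · exact hP.disjoint (Or.inr ⟨h3, rfl⟩)

/-! ### Monodromy -/

/-- The points above the centre of a tile. -/
def center (i : Δ.Tile) (k : K) : Cover φ :=
  -- A square is indexed by the sheet of its right-hand centre; the factor `φ e` puts the left-hand
  -- centre in sheet `k`.
  Quotient.lift (fun e => square φ e (k * φ e) (0, 1)) (fun _ _ h =>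
    eq_of_sameCycle (F := fun e => square φ e (k * φ e) (0, 1)) (fun e => by
      have h1 := square_white (φ := φ) e (k * φ e) 1
      have h2 := square_black (φ := φ) (Δ.σ e) k 0
      rw [mul_inv_cancel_right] at h1
      exact (h1.trans h2).symm) h) i

theorem square_left (e : Δ.Edge) (k : K) :
    square φ e k (0, 1) = center (leftTile e) (k * (φ e)⁻¹) := by
  change _ = square φ e (k * (φ e)⁻¹ * φ e) (0, 1)
  rw [inv_mul_cancel_right]

theorem square_right (e : Δ.Edge) (k : K) :
    square φ e k (1, 0) = center (rightTile e) k := square_black e k 0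

theorem proj_center (i : Δ.Tile) (k : K) :
    proj φ (center i k) = BipartiteRotationSystem.center i := by
  obtain ⟨e, rfl⟩ := Quotient.exists_rep i
  rfl

theorem smul_center (g : K) (i : Δ.Tile) (k : K) :
    g • center (φ := φ) i k = center i (g * k) := by
  obtain ⟨e, rfl⟩ := Quotient.exists_rep i
  change square φ e (g * (k * φ e)) (0, 1) = square φ e (g * k * φ e) (0, 1)
  rw [mul_assoc]

section monodromy

variable (cov : IsCoveringMap (proj φ))

/-- The same segment in the square of index `k` lifts the given one. -/
theorem monodromy_lineClass (e : Δ.Edge) (k : K) {a b : unitInterval × unitInterval}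
    {x y : Δ.Realization} (hx : BipartiteRotationSystem.square e a = x)
    (hy : BipartiteRotationSystem.square e b = y) (z : proj φ ⁻¹' {x})
    (hz : z.1 = square φ e k a) :
    (cov.monodromy (lineClass e a b hx hy) z).1 = square φ e k b := by
  subst hx hy
  obtain ⟨z, hz'⟩ := z
  subst hz
  have h := cov.monodromy_map ((Path.Homotopic.Quotient.mk (squareLine a b)).map (square φ e k))
  rw [← Path.Homotopic.Quotient.map_comp] at h
  rw [lineClass, Path.Homotopic.Quotient.cast_rfl_rfl]
  exact congrArg Subtype.val h

theorem monodromy_symm {x y : Δ.Realization} (γ : Path.Homotopic.Quotient x y)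
    (z : proj φ ⁻¹' {x}) : cov.monodromy γ.symm (cov.monodromy γ z) = z := by
  rw [← cov.monodromy_trans_apply, Path.Homotopic.Quotient.trans_symm, cov.monodromy_refl]
  rfl

theorem monodromy_pathClass {i j : Quiver.Symmetrify Δ.Tile} (q : Quiver.Path i j) (k : K)
    (z : proj φ ⁻¹' {BipartiteRotationSystem.center i}) (hz : z.1 = center i k) :
    (cov.monodromy (pathClass q) z).1 = center j (k * (holonomy φ q)⁻¹) := by
  induction q with
  | nil => 
    rw [pathClass, cov.monodromy_refl, holonomy_nil, inv_one, mul_one]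
    exact hz
  | cons q a ih =>
    rcases a with ⟨a, rfl, rfl⟩ | ⟨a, rfl, rfl⟩
    · simp only [holonomy, pathClass]
      rw [cov.monodromy_trans_apply, monodromy_lineClass cov a _ _ _ _
        (ih.trans (square_right a _).symm), square_left, mul_inv_rev, mul_assoc]
    · simp only [holonomy, pathClass]
      -- For a reverse crossing, the lift runs in the square whose left-hand centre is the current
      -- point, hence the extra factor `φ a` in the index.
      rw [cov.monodromy_trans_apply, monodromy_lineClass cov a
        (k * (holonomy φ q)⁻¹ * φ a) _ _ _ (ih.trans ?_), square_right, mul_inv_rev, inv_inv,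
        mul_assoc]
      rw [square_left, mul_inv_cancel_right]

end monodromy

end Cover

/-! ### Injectivity by monodromy -/

section Isomorphism

variable {i₀ : Quiver.Symmetrify Δ.Tile} {p : ∀ i : Quiver.Symmetrify Δ.Tile, Quiver.Path i₀ i}

/-- In the covering given by the tautological map from edges to the surface group, the paths `p i`
preserve the sheet and crossing `e` multiplies it by the inverse of `e`. Monodromy after `loopHom`
is thus inversion, which is injective. -/
theorem loopHom_injective (hp : p i₀ = Quiver.Path.nil) : Function.Injective (loopHom hp) := by
  let φ : Δ.Edge → SurfaceGroup p := PresentedGroup.of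
  have hc : IsQuotientCoveringMap (Cover.proj φ) (SurfaceGroup p) :=
    Cover.isQuotientCoveringMap_proj SurfaceGroup.cycleProd_σ SurfaceGroup.cycleProd_τ_symm
  let cov := hc.isCoveringMap
  let z : ∀ (i : Quiver.Symmetrify Δ.Tile) (k : SurfaceGroup p), Cover.proj φ ⁻¹' {center i} :=
    fun i k => ⟨Cover.center i k, Cover.proj_center i k⟩
  have hB : ∀ i k, cov.monodromy (pathClass (p i)) (z i₀ k) = z i k := fun i k => by
    refine Subtype.ext ?_
    rw [Cover.monodromy_pathClass cov (p i) k _ rfl, SurfaceGroup.holonomy_eq, inv_one, mul_one]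
  let M := hc.fundamentalGroupToMulOpposite (z i₀ 1)
  have hM : M.comp (loopHom hp) = (MulEquiv.inv' (SurfaceGroup p)).toMonoidHom := by
    refine PresentedGroup.ext fun e => ?_
    rw [MonoidHom.comp_apply, loopHom_of]
    refine hc.fundamentalGroupToMulOpposite_apply_eq_Iff.2 ?_
    change (φ e)⁻¹ • Cover.center i₀ 1 = (cov.monodromy (loop _ e) (z i₀ 1)).1
    have h1 : cov.monodromy (lineClass e (1, 0) (0, 1) (square_right e) (square_left e))
        (z (rightTile e) 1) = z (leftTile e) (φ e)⁻¹ := Subtype.ext <| by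
      rw [Cover.monodromy_lineClass cov e 1 _ _ _ (Cover.square_right e 1).symm,
        Cover.square_left, one_mul]
    change _ = (cov.monodromy (((pathClass (p (rightTile e))).trans (lineClass e (1, 0) (0, 1)
      (square_right e) (square_left e))).trans (pathClass (p (leftTile e))).symm) (z i₀ 1)).1
    have h2 : cov.monodromy (pathClass (p (leftTile e))).symm (z (leftTile e) (φ e)⁻¹) =
        z i₀ (φ e)⁻¹ :=
      (congrArg _ (hB (leftTile e) (φ e)⁻¹).symm).trans (Cover.monodromy_symm cov _ _)
    have h3 := congrArg (cov.monodromy (lineClass e (1, 0) (0, 1) (square_right e)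
      (square_left e))) (hB (rightTile e) 1)
    rw [cov.monodromy_trans_apply, cov.monodromy_trans_apply]
    refine Eq.trans ?_ (congrArg Subtype.val ((congrArg _ (h3.trans h1)).trans h2)).symm
    exact (Cover.smul_center (φ e)⁻¹ i₀ 1).trans (congrArg (Cover.center i₀) (mul_one _))
  have h : Function.Injective (M.comp (loopHom hp)) := by
    rw [hM]
    exact (MulEquiv.inv' (SurfaceGroup p)).injective
  exact Function.Injective.of_comp (f := M) h

end Isomorphism

end BipartiteRotationSystem

/-! ### Matrix units -/

/-- A family of elements of a ring that multiply like elementary matrices. -/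
structure IsMatrixUnits {ι A : Type*} [Fintype ι] [Semiring A] (E : ι → ι → A) : Prop where
  mul_eq (i j l : ι) : E i j * E j l = E i l
  mul_of_ne (i : ι) {j k : ι} (l : ι) (h : j ≠ k) : E i j * E k l = 0
  sum_eq : ∑ i, E i i = 1

namespace IsMatrixUnits

variable {ι A : Type*} [Fintype ι] [Ring A] {E : ι → ι → A}

/-- An element `z` of the centralizer of the matrix units is a scalar matrix, recovered from a
single entry as `∑ k, E k i * (z * E i j) * E j k`. -/
theorem eq_of_mul_eq (hE : IsMatrixUnits E) {x y : A} (hx : ∀ i j, Commute x (E i j))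
    (hy : ∀ i j, Commute y (E i j)) {i j : ι} (h : x * E i j = y * E i j) : x = y := by
  have key : ∀ z : A, (∀ i j, Commute z (E i j)) → ∑ k, E k i * (z * E i j) * E j k = z := by
    intro z hz
    have h1 : ∀ k, E k i * (z * E i j) * E j k = z * E k k := fun k => by
      rw [← mul_assoc, ← (hz k i).eq, mul_assoc z, hE.mul_eq, mul_assoc, hE.mul_eq]
    simp only [h1]
    rw [← Finset.mul_sum, hE.sum_eq, mul_one]
  rw [← key x hx, h, key y hy]

/-- The sum `∑ i, E i l * x * E r i` repeats the entry `x` from `r` to `l` along the diagonal; such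
scalar matrices multiply entrywise. -/
theorem sum_mul_sum (hE : IsMatrixUnits E) (x y : A) (r l : ι) :
    (∑ i, E i l * x * E r i) * ∑ i, E i r * y * E l i =
      ∑ i, E i l * (x * E r r * y) * E l i := by
  classical
  rw [Finset.sum_mul]
  refine Finset.sum_congr rfl fun i _ => ?_
  rw [Finset.mul_sum, Finset.sum_eq_single i]
  · simp only [mul_assoc]
    rw [← mul_assoc (E r i), hE.mul_eq]
  · intro j _ hj
    simp only [mul_assoc]
    rw [← mul_assoc (E r i), hE.mul_of_ne _ _ hj.symm, zero_mul, mul_zero, mul_zero]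
  · simp

theorem sum_eq_one (hE : IsMatrixUnits E) (l : ι) : ∑ i, E i l * E l l * E l i = 1 := by
  simp only [hE.mul_eq]
  exact hE.sum_eq

theorem sum_mul (hE : IsMatrixUnits E) (x : A) (r l j k : ι) :
    (∑ i, E i l * x * E r i) * E j k = E j l * x * E r k := by
  classical
  rw [Finset.sum_mul, Finset.sum_eq_single j]
  · rw [mul_assoc, hE.mul_eq]
  · intro i _ hi
    rw [mul_assoc, hE.mul_of_ne _ _ hi, mul_zero]
  · simp

theorem commute_sum (hE : IsMatrixUnits E) (x : A) (r l j k : ι) :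
    Commute (∑ i, E i l * x * E r i) (E j k) := by
  classical
  refine (hE.sum_mul x r l j k).trans ?_
  rw [Finset.mul_sum, Finset.sum_eq_single k]
  · rw [← mul_assoc, ← mul_assoc, hE.mul_eq]
  · intro i _ hi
    rw [← mul_assoc, ← mul_assoc, hE.mul_of_ne _ _ hi.symm, zero_mul, zero_mul]
  · simp

/-- If `a : r → l` and `b : l → r` are mutually inverse arrows, then the endomorphism that acts as
`a` in every component is invertible. -/
def unit (hE : IsMatrixUnits E) {a b : A} {r l : ι} (hab : a * E r r * b = E l l)
    (hba : b * E l l * a = E r r) : Aˣ where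
  val := ∑ i, E i l * a * E r i
  inv := ∑ i, E i r * b * E l i
  val_inv := by rw [hE.sum_mul_sum, hab, hE.sum_eq_one]
  inv_val := by rw [hE.sum_mul_sum, hba, hE.sum_eq_one]

end IsMatrixUnits

namespace BipartiteRotationSystem

variable {Δ : BipartiteRotationSystem}

/-! ### Cyclic derivatives of walks -/

/-- The list of the edges crossed by a path in the dual quiver. -/
def edgeList {i : Δ.Tile} : ∀ {j : Δ.Tile}, Quiver.Path i j → List Δ.Edge
  | _, .nil => []
  | _, .cons q a => edgeList q ++ [a.1]

theorem length_edgeList {i j : Δ.Tile} (q : Quiver.Path i j) :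
    (edgeList q).length = q.length := by
  induction q with
  | nil => rfl
  | cons q a ih => simp [edgeList, ih]

theorem edgeList_comp {i j l : Δ.Tile} (q : Quiver.Path i j) (r : Quiver.Path j l) :
    edgeList (q.comp r) = edgeList q ++ edgeList r := by
  induction r with
  | nil => simp [edgeList]
  | cons r a ih => simp [edgeList, ih]

theorem edgeList_walk (ρ : Equiv.Perm Δ.Edge) (hρ : ∀ e, leftTile e = rightTile (ρ e)) (e : Δ.Edge)
    (n : ℕ) : edgeList (walk ρ hρ e n) = (List.range n).map fun k => (ρ ^ k) e := by
  induction n with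
  | zero => rfl
  | succ n ih => simp [edgeList, walk, ih, List.range_succ]

theorem exists_decomposition {i j : Δ.Tile} (q : Quiver.Path i j) {f : Δ.Edge}
    (hf : f ∈ edgeList q) : ∃ (w : Quiver.Path i (rightTile f)) (v : Quiver.Path (leftTile f) j),
      (w.cons (dualArrow f)).comp v = q := by
  induction q with
  | nil => simp [edgeList] at hf
  | cons q a ih =>
    rw [edgeList, List.mem_append, List.mem_singleton] at hf
    rcases hf with hf | rfl
    · obtain ⟨w, v, rfl⟩ := ih hf
      exact ⟨w, v.cons a, rfl⟩
    · obtain ⟨f, rfl, rfl⟩ := a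
      exact ⟨q, Quiver.Path.nil, rfl⟩

/-- The product of the values of `φ` along a path of the dual quiver. -/
def pathProd {M : Type*} [Monoid M] (φ : Δ.Edge → M) {i j : Δ.Tile} (q : Quiver.Path i j) : M :=
  ((edgeList q).map φ).reverse.prod

theorem pathProd_comp {M : Type*} [Monoid M] (φ : Δ.Edge → M) {i j l : Δ.Tile}
    (q : Quiver.Path i j) (r : Quiver.Path j l) :
    pathProd φ (q.comp r) = pathProd φ r * pathProd φ q := by
  simp [pathProd, edgeList_comp]

theorem prod_reverse_range {M : Type*} [Monoid M] (φ : Δ.Edge → M) (ρ : Equiv.Perm Δ.Edge)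
    (e : Δ.Edge) (n : ℕ) :
    (((List.range n).map fun k => (ρ ^ k) e).map φ).reverse.prod = walkProd φ ρ e n := by
  induction n with
  | zero => simp [walkProd]
  | succ n ih =>
    rw [List.range_succ, walkProd, ← ih]
    simp

/-- The position of an arrow in a walk determines the two parts into which it divides the walk. -/
theorem decomposition_walk {ρ : Equiv.Perm Δ.Edge} {e f : Δ.Edge} {n : ℕ} {t : Δ.Tile}
    {w : Quiver.Path (rightTile e) (rightTile f)} {v : Quiver.Path (leftTile f) t}
    (h : edgeList ((w.cons (dualArrow f)).comp v) = (List.range n).map fun k => (ρ ^ k) e) :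
    w.length + 1 + v.length = n ∧ (ρ ^ w.length) e = f ∧
      edgeList w = ((List.range w.length).map fun k => (ρ ^ k) e) ∧
      edgeList v = ((List.range v.length).map fun k => (ρ ^ k) ((ρ ^ (w.length + 1)) e)) := by
  have h1 := h
  rw [edgeList_comp, edgeList] at h1
  have h2 := congrArg List.length h1
  simp only [List.length_append, length_edgeList, List.length_singleton, List.length_map,
    List.length_range] at h2
  rw [← h2, List.range_add, List.range_succ, List.map_append, List.map_append, List.map_map] at h1
  obtain ⟨h3, h4⟩ := List.append_inj h1 (by simp [length_edgeList])
  obtain ⟨h5, h6⟩ := List.append_inj h3 (by simp [length_edgeList])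
  refine ⟨h2, ?_, h5, h4.trans ?_⟩
  · simp only [List.map_cons, List.map_nil, List.cons.injEq, and_true] at h6
    exact h6.symm
  · refine List.map_congr_left fun k _ => ?_
    rw [Function.comp_apply, add_comm, pow_add, Equiv.Perm.mul_apply]

section CyclicDerivative

variable {A : Type*} [Ring A] [Algebra ℂ A] {U : Δ.Edge → Aˣ} {E : Δ.Tile → Δ.Tile → A}
  {L : PathAlgebra ℂ Δ.Tile →ₗ[ℂ] A}
  (hL : ∀ {i j : Δ.Tile} (q : Quiver.Path i j),
    L (PathAlgebra.path ℂ q) = (pathProd U q : Aˣ) * E j i)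

include hL in
theorem eval_path_mul_path {i j s t : Δ.Tile} (h : t = s) (w : Quiver.Path s i)
    (v : Quiver.Path j t) : L (PathAlgebra.path ℂ w * PathAlgebra.path ℂ v) =
      (pathProd U w * pathProd U v : Aˣ) * E i j := by
  subst h
  rw [PathAlgebra.mul_eq, PathAlgebra.mulMap_path, hL, pathProd_comp]

include hL in
open Classical in
-- An edge occurs at most once in a minimal cycle, so the derivative has at most one term. That term
-- is the cycle with `f` removed, and `walkProd_mul_walkProd` evaluates it. Stating this for any `L`
-- of the given shape covers both the target matrix algebra and the Jacobi algebra itself.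
theorem eval_cyclicDerivative_walk (ρ : Equiv.Perm Δ.Edge)
    (hρ : ∀ e, leftTile e = rightTile (ρ e)) (e f : Δ.Edge) :
    L (PathAlgebra.cyclicDerivative (dualArrow f)
      (PathAlgebra.of ℂ ⟨_, _, walk ρ hρ e (Function.minimalPeriod ρ e)⟩)) =
      if ρ.SameCycle e f then
        (cycleProd U ρ f * (U f)⁻¹ : Aˣ) * E (rightTile f) (leftTile f) else 0 := by
  rw [PathAlgebra.cyclicDerivative, PathAlgebra.lift_of]
  split_ifs with hef
  · obtain ⟨n, -, hn⟩ := hef.exists_pow_eq'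
    have hpos : 0 < Function.minimalPeriod ρ e :=
      Function.minimalPeriod_pos_of_mem_periodicPts
        (Function.Injective.mem_periodicPts ρ.injective e)
    obtain ⟨w, v, hwv⟩ := exists_decomposition (walk ρ hρ e (Function.minimalPeriod ρ e)) (f := f)
      (by
        rw [edgeList_walk, List.mem_map]
        refine ⟨n % Function.minimalPeriod ρ e, List.mem_range.2 (Nat.mod_lt _ hpos), ?_⟩
        rw [Equiv.Perm.coe_pow, Function.iterate_mod_minimalPeriod_eq, ← Equiv.Perm.coe_pow, hn])
    obtain ⟨h1, h2, h3, h4⟩ := decomposition_walk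
      ((congrArg edgeList hwv).trans (edgeList_walk ρ hρ e _))
    rw [finsum_eq_single _ ⟨(w, v), hwv⟩]
    · rw [eval_path_mul_path hL (congrArg rightTile (pow_minimalPeriod_apply ρ e))]
      congr 2
      rw [pathProd, pathProd, h3, h4, prod_reverse_range, prod_reverse_range,
        walkProd_mul_walkProd U ρ e h1, h2]
    · rintro ⟨⟨w', v'⟩, hwv'⟩ hne
      obtain ⟨h1', h2', -, -⟩ := decomposition_walk
        ((congrArg edgeList hwv').trans (edgeList_walk ρ hρ e _))
      -- Both lengths are below the period and lead from `e` to the same edge.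
      have hl : w'.length = w.length := by
        have h5 := h2'.trans h2.symm
        simp only [Equiv.Perm.coe_pow] at h5
        refine (Function.iterate_eq_iterate_iff_of_lt_minimalPeriod (lt_of_lt_of_eq ?_ h1')
          (by omega)).1 h5
        change w'.length < w'.length + 1 + v'.length
        omega
      obtain ⟨h6, h7⟩ := (Quiver.Path.comp_inj' (by simp [hl])).1 (hwv'.trans hwv.symm)
      simp only [Quiver.Path.cons.injEq, heq_eq_eq, true_and, and_true] at h6
      subst h6 h7
      exact absurd rfl hne
  · have : IsEmpty {d : Quiver.Path (rightTile e) (rightTile f) × Quiver.Path (leftTile f) _ //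
        (d.1.cons (dualArrow f)).comp d.2 = walk ρ hρ e (Function.minimalPeriod ρ e)} :=
      ⟨fun ⟨⟨w, v⟩, h⟩ => hef ⟨w.length, (decomposition_walk
        ((congrArg edgeList h).trans (edgeList_walk ρ hρ e _))).2.1⟩⟩
    exact (congrArg L (finsum_of_isEmpty _)).trans (map_zero L)

variable (Δ) in
include hL in
-- Only the cycles at the two endpoints of `f` contain `f`.
theorem eval_cyclicDerivative_potential (f : Δ.Edge) :
    L (PathAlgebra.cyclicDerivative (dualArrow f) Δ.potential) =
      (cycleProd U Δ.σ f * (U f)⁻¹ : Aˣ) * E (rightTile f) (leftTile f) -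
        (cycleProd U Δ.τ.symm f * (U f)⁻¹ : Aˣ) * E (rightTile f) (leftTile f) := by
  classical
  rw [potential, map_sub, map_sub, map_sum, map_sum, map_sum, map_sum]
  congr 1
  · rw [Finset.sum_eq_single (white f)]
    · rw [whiteCycle, eval_cyclicDerivative_walk hL, if_pos]
      exact Quotient.mk_out (s := Equiv.Perm.SameCycle.setoid Δ.σ) f
    · intro v _ hv
      rw [whiteCycle, eval_cyclicDerivative_walk hL, if_neg]
      intro h
      exact hv ((Quotient.out_eq v).symm.trans (Quotient.sound h))
    · simp
  · rw [Finset.sum_eq_single (black f)]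
    · rw [blackCycle, eval_cyclicDerivative_walk hL, if_pos]
      exact Equiv.Perm.sameCycle_inv.2
        (Quotient.mk_out (s := Equiv.Perm.SameCycle.setoid Δ.τ) f)
    · intro v _ hv
      rw [blackCycle, eval_cyclicDerivative_walk hL, if_neg]
      intro h
      exact hv ((Quotient.out_eq v).symm.trans (Quotient.sound (Equiv.Perm.sameCycle_inv.1 h)))
    · simp

end CyclicDerivative

/-! ### Representations of the localized Jacobi algebra by matrix units -/

theorem holonomy_mapPath {K : Type*} [Group K] (φ : Δ.Edge → K) {i j : Δ.Tile}
    (q : Quiver.Path i j) : holonomy φ (Quiver.Symmetrify.of.mapPath q) = pathProd φ q := by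
  induction q with
  | nil => exact holonomy_nil φ
  | cons q a ih =>
    refine (congrArg (φ a.1 * ·) ih).trans ?_
    simp [pathProd, edgeList]

/-- The tile on the right of an edge, as a vertex of the quiver with inverse arrows added. -/
def tail (e : Δ.Edge) : Quiver.Symmetrify Δ.Tile := rightTile e

/-- The tile on the left of an edge, as a vertex of the quiver with inverse arrows added. -/
def head (e : Δ.Edge) : Quiver.Symmetrify Δ.Tile := leftTile e

/-- The arrow dual to an edge in the quiver with inverse arrows added. -/
def posArrow (e : Δ.Edge) : tail e ⟶ head e :=
  @Quiver.Hom.toPos Δ.Tile _ (rightTile e) (leftTile e) (dualArrow e)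

/-- The inverse of the arrow dual to an edge in the quiver with inverse arrows added. -/
def negArrow (e : Δ.Edge) : head e ⟶ tail e :=
  @Quiver.Hom.toNeg Δ.Tile _ (rightTile e) (leftTile e) (dualArrow e)

theorem holonomy_posArrow {K : Type*} [Group K] (φ : Δ.Edge → K) (e : Δ.Edge) :
    holonomy φ (posArrow e).toPath = φ e := mul_one _

theorem holonomy_negArrow {K : Type*} [Group K] (φ : Δ.Edge → K) (e : Δ.Edge) :
    holonomy φ (negArrow e).toPath = (φ e)⁻¹ := mul_one _

section Representation

variable {A : Type*} [Ring A] {U : Δ.Edge → Aˣ}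
  {E : Quiver.Symmetrify Δ.Tile → Quiver.Symmetrify Δ.Tile → A}

theorem commute_holonomy (hU : ∀ e i j, Commute (U e : A) (E i j)) {i j : Quiver.Symmetrify Δ.Tile}
    (q : Quiver.Path i j) (k l : Quiver.Symmetrify Δ.Tile) :
    Commute ((holonomy U q : Aˣ) : A) (E k l) := by
  induction q with
  | nil => simp
  | cons q a ih =>
    rcases a with a | a <;> simp only [holonomy, Units.val_mul]
    · exact (hU _ _ _).mul_left ih
    · exact (hU a.1 k l).units_inv_left.mul_left ih

variable [Algebra ℂ A]

/-- The algebra homomorphism out of the path algebra given by matrix units and units that commute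
with them. -/
def pathHom (hE : IsMatrixUnits E) (hU : ∀ e i j, Commute (U e : A) (E i j)) :
    PathAlgebra ℂ (Quiver.Symmetrify Δ.Tile) →ₐ[ℂ] A :=
  AlgHom.ofLinearMap (PathAlgebra.lift (M := A)
      fun q => ((holonomy U q.2.2 : Aˣ) : A) * E q.2.1 q.1)
    (by
      rw [PathAlgebra.one_eq, map_sum]
      refine Eq.trans ?_ hE.sum_eq
      refine Finset.sum_congr rfl fun i _ => ?_
      rw [PathAlgebra.vertex, PathAlgebra.path, PathAlgebra.lift_of, holonomy_nil, Units.val_one,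
        one_mul])
    (by
      rw [LinearMap.map_mul_iff]
      refine PathAlgebra.hom_ext ℂ fun ⟨j, l, r⟩ => PathAlgebra.hom_ext ℂ fun ⟨i, j', q⟩ => ?_
      change PathAlgebra.lift (M := A) _ (PathAlgebra.mulMap ℂ (PathAlgebra.path ℂ r)
        (PathAlgebra.path ℂ q)) = PathAlgebra.lift (M := A) _ (PathAlgebra.of ℂ ⟨j, l, r⟩) *
          PathAlgebra.lift (M := A) _ (PathAlgebra.of ℂ ⟨i, j', q⟩)
      simp only [PathAlgebra.lift_of]
      rw [mul_assoc, ← mul_assoc (E l j), ← (commute_holonomy hU q l j).eq]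
      by_cases h : j' = j
      · subst h
        rw [PathAlgebra.mulMap_path, PathAlgebra.path, PathAlgebra.lift_of, holonomy_comp,
          mul_assoc, hE.mul_eq, Units.val_mul, mul_assoc]
      · rw [PathAlgebra.mulMap_path_of_ne _ _ _ h, map_zero, mul_assoc,
          hE.mul_of_ne _ _ (Ne.symm h), mul_zero, mul_zero])

theorem pathHom_path (hE : IsMatrixUnits E) (hU : ∀ e i j, Commute (U e : A) (E i j))
    {i j : Quiver.Symmetrify Δ.Tile} (q : Quiver.Path i j) :
    pathHom hE hU (PathAlgebra.path ℂ q) = (holonomy U q : Aˣ) * E j i :=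
  PathAlgebra.lift_of ℂ (fun q : TotalPath (Quiver.Symmetrify Δ.Tile) =>
    ((holonomy U q.2.2 : Aˣ) : A) * E q.2.1 q.1) _

/-- The algebra homomorphism out of the localized path algebra given by matrix units and units that
commute with them. -/
def localizedHom (hE : IsMatrixUnits E) (hU : ∀ e i j, Commute (U e : A) (E i j)) :
    LocalizedPathAlgebra ℂ Δ.Tile →ₐ[ℂ] A :=
  RingQuot.liftAlgHom ℂ ⟨pathHom hE hU, by
    rintro _ _ (⟨⟨e, rfl, rfl⟩⟩ | ⟨⟨e, rfl, rfl⟩⟩)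
    · change pathHom hE hU (PathAlgebra.path ℂ (negArrow e).toPath *
        PathAlgebra.path ℂ (posArrow e).toPath) =
          pathHom hE hU (PathAlgebra.path ℂ (Quiver.Path.nil : Quiver.Path (tail e) (tail e)))
      rw [PathAlgebra.mul_eq, PathAlgebra.mulMap_path, pathHom_path, pathHom_path, holonomy_comp,
        holonomy_posArrow, holonomy_negArrow, holonomy_nil]
      simp
    · change pathHom hE hU (PathAlgebra.path ℂ (posArrow e).toPath *
        PathAlgebra.path ℂ (negArrow e).toPath) =
          pathHom hE hU (PathAlgebra.path ℂ (Quiver.Path.nil : Quiver.Path (head e) (head e)))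
      rw [PathAlgebra.mul_eq, PathAlgebra.mulMap_path, pathHom_path, pathHom_path, holonomy_comp,
        holonomy_posArrow, holonomy_negArrow, holonomy_nil]
      simp⟩

theorem localizedHom_path (hE : IsMatrixUnits E) (hU : ∀ e i j, Commute (U e : A) (E i j))
    {i j : Quiver.Symmetrify Δ.Tile} (q : Quiver.Path i j) :
    localizedHom hE hU (RingQuot.mkAlgHom ℂ _ (PathAlgebra.path ℂ q)) =
      (holonomy U q : Aˣ) * E j i := by
  rw [localizedHom, RingQuot.liftAlgHom_mkAlgHom_apply, pathHom_path]

theorem localizedHom_cyclicDerivative (hE : IsMatrixUnits E)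
    (hU : ∀ e i j, Commute (U e : A) (E i j)) (f : Δ.Edge) :
    localizedHom hE hU (PathAlgebra.toLocalized ℂ Δ.Tile
      (PathAlgebra.cyclicDerivative (dualArrow f) Δ.potential)) =
      (cycleProd U Δ.σ f * (U f)⁻¹ : Aˣ) * E (rightTile f) (leftTile f) -
        (cycleProd U Δ.τ.symm f * (U f)⁻¹ : Aˣ) * E (rightTile f) (leftTile f) :=
  eval_cyclicDerivative_potential Δ
    (L := (localizedHom hE hU).toLinearMap.comp (PathAlgebra.toLocalized ℂ Δ.Tile))
    (fun q => by
      rw [LinearMap.comp_apply, PathAlgebra.toLocalized, PathAlgebra.path, PathAlgebra.lift_of,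
        ← holonomy_mapPath]
      exact localizedHom_path hE hU _) f

/-- The algebra homomorphism out of the localized Jacobi algebra given by matrix units and units
that commute with them and satisfy the relations given by the potential. -/
def jacobiHom (hE : IsMatrixUnits E) (hU : ∀ e i j, Commute (U e : A) (E i j))
    (h : ∀ e, cycleProd U Δ.σ e = cycleProd U Δ.τ.symm e) :
    LocalizedJacobiAlgebra Δ.potential →ₐ[ℂ] A :=
  RingQuot.liftAlgHom ℂ ⟨localizedHom hE hU, by
    rintro _ _ ⟨⟨e, rfl, rfl⟩⟩
    rw [map_zero]
    refine (localizedHom_cyclicDerivative hE hU e).trans ?_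
    rw [h, sub_self]⟩

end Representation

variable (Δ) in
/-- The quotient map from the path algebra onto the localized Jacobi algebra. -/
def jacobiMk : PathAlgebra ℂ (Quiver.Symmetrify Δ.Tile) →ₐ[ℂ] LocalizedJacobiAlgebra Δ.potential :=
  (RingQuot.mkAlgHom ℂ (JacobiRel Δ.potential)).comp
    (RingQuot.mkAlgHom ℂ (LocalizationRel ℂ Δ.Tile))

theorem jacobiHom_path {A : Type*} [Ring A] [Algebra ℂ A] {U : Δ.Edge → Aˣ}
    {E : Quiver.Symmetrify Δ.Tile → Quiver.Symmetrify Δ.Tile → A} (hE : IsMatrixUnits E)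
    (hU : ∀ e i j, Commute (U e : A) (E i j))
    (h : ∀ e, cycleProd U Δ.σ e = cycleProd U Δ.τ.symm e)
    {i j : Quiver.Symmetrify Δ.Tile} (q : Quiver.Path i j) :
    jacobiHom hE hU h (jacobiMk Δ (PathAlgebra.path ℂ q)) = (holonomy U q : Aˣ) * E j i := by
  rw [jacobiHom, jacobiMk, AlgHom.comp_apply, RingQuot.liftAlgHom_mkAlgHom_apply, localizedHom_path]

/-! ### Matrix units in the localized Jacobi algebra -/

variable (Δ) in
/-- The class of a path in the localized Jacobi algebra. -/
def pathMk {i j : Quiver.Symmetrify Δ.Tile} (q : Quiver.Path i j) :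
    LocalizedJacobiAlgebra Δ.potential := jacobiMk Δ (PathAlgebra.path ℂ q)

theorem pathMk_mul {i j l : Quiver.Symmetrify Δ.Tile} (r : Quiver.Path j l)
    (q : Quiver.Path i j) : pathMk Δ r * pathMk Δ q = pathMk Δ (q.comp r) := by
  rw [pathMk, pathMk, ← map_mul, PathAlgebra.mul_eq, PathAlgebra.mulMap_path, pathMk]

theorem pathMk_mul_of_ne {i j k l : Quiver.Symmetrify Δ.Tile} (r : Quiver.Path k l)
    (q : Quiver.Path i j) (h : j ≠ k) : pathMk Δ r * pathMk Δ q = 0 := by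
  rw [pathMk, pathMk, ← map_mul, PathAlgebra.mul_eq, PathAlgebra.mulMap_path_of_ne _ _ _ h,
    map_zero]

theorem sum_pathMk_nil :
    ∑ i : Quiver.Symmetrify Δ.Tile, pathMk Δ (Quiver.Path.nil : Quiver.Path i i) = 1 := by
  rw [← map_one (jacobiMk Δ), PathAlgebra.one_eq, map_sum]
  rfl

theorem pathMk_reverse_mul_arrow {i j : Quiver.Symmetrify Δ.Tile} (a : i ⟶ j) :
    pathMk Δ (Quiver.reverse a).toPath * pathMk Δ a.toPath =
      pathMk Δ (Quiver.Path.nil : Quiver.Path i i) := by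
  rcases a with ⟨a, rfl, rfl⟩ | ⟨a, rfl, rfl⟩
  · have h := congrArg (RingQuot.mkAlgHom ℂ (JacobiRel Δ.potential))
      (RingQuot.mkAlgHom_rel ℂ (LocalizationRel.star_mul (k := ℂ) (dualArrow a)))
    rw [map_mul, map_mul] at h
    exact h
  · have h := congrArg (RingQuot.mkAlgHom ℂ (JacobiRel Δ.potential))
      (RingQuot.mkAlgHom_rel ℂ (LocalizationRel.mul_star (k := ℂ) (dualArrow a)))
    rw [map_mul, map_mul] at h
    exact h

theorem pathMk_reverse_mul {i j : Quiver.Symmetrify Δ.Tile} (q : Quiver.Path i j) :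
    pathMk Δ q.reverse * pathMk Δ q = pathMk Δ (Quiver.Path.nil : Quiver.Path i i) := by
  induction q with
  | nil => rw [Quiver.Path.reverse, pathMk_mul, Quiver.Path.nil_comp]
  | cons q a ih =>
    rw [Quiver.Path.reverse, ← pathMk_mul, mul_assoc, ← Quiver.Path.comp_toPath_eq_cons,
      ← pathMk_mul, ← mul_assoc (pathMk Δ _) (pathMk Δ a.toPath), pathMk_reverse_mul_arrow,
      pathMk_mul, Quiver.Path.comp_nil, ih]

theorem pathMk_mul_reverse {i j : Quiver.Symmetrify Δ.Tile} (q : Quiver.Path i j) :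
    pathMk Δ q * pathMk Δ q.reverse = pathMk Δ (Quiver.Path.nil : Quiver.Path j j) := by
  have h := pathMk_reverse_mul q.reverse
  rwa [Quiver.Path.reverse_reverse] at h

section Units

variable {i₀ : Quiver.Symmetrify Δ.Tile} (p : ∀ i : Quiver.Symmetrify Δ.Tile, Quiver.Path i₀ i)

/-- The matrix units of the localized Jacobi algebra given by a tree of paths. -/
def jacobiUnits (i j : Quiver.Symmetrify Δ.Tile) : LocalizedJacobiAlgebra Δ.potential :=
  pathMk Δ (p i) * pathMk Δ (p j).reverse

theorem jacobiUnits_self (i : Quiver.Symmetrify Δ.Tile) :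
    jacobiUnits p i i = pathMk Δ (Quiver.Path.nil : Quiver.Path i i) :=
  pathMk_mul_reverse (p i)

theorem isMatrixUnits_jacobiUnits : IsMatrixUnits (jacobiUnits p) where
  mul_eq i j l := by
    rw [jacobiUnits, jacobiUnits, jacobiUnits, mul_assoc,
      ← mul_assoc (pathMk Δ (p j).reverse), pathMk_reverse_mul, ← mul_assoc,
      pathMk_mul, Quiver.Path.nil_comp]
  mul_of_ne i j k l h := by
    rw [jacobiUnits, jacobiUnits, mul_assoc, ← mul_assoc (pathMk Δ (p j).reverse),
      pathMk_mul_of_ne _ _ h.symm, zero_mul, mul_zero]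
  sum_eq := by
    refine Eq.trans ?_ (sum_pathMk_nil (Δ := Δ))
    exact Finset.sum_congr rfl fun i _ => jacobiUnits_self p i

/-- The unit of the localized Jacobi algebra given by an edge. -/
def edgeUnit (e : Δ.Edge) : (LocalizedJacobiAlgebra Δ.potential)ˣ :=
  (isMatrixUnits_jacobiUnits p).unit (r := tail e) (l := head e)
    (a := pathMk Δ (posArrow e).toPath) (b := pathMk Δ (negArrow e).toPath)
    (by
      rw [jacobiUnits_self, jacobiUnits_self, pathMk_mul, Quiver.Path.nil_comp]
      exact pathMk_reverse_mul_arrow (negArrow e))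
    (by
      rw [jacobiUnits_self, jacobiUnits_self, pathMk_mul, Quiver.Path.nil_comp]
      exact pathMk_reverse_mul_arrow (posArrow e))

theorem commute_edgeUnit (e : Δ.Edge) (i j : Quiver.Symmetrify Δ.Tile) :
    Commute (edgeUnit p e : LocalizedJacobiAlgebra Δ.potential) (jacobiUnits p i j) :=
  (isMatrixUnits_jacobiUnits p).commute_sum _ _ _ i j

theorem edgeUnit_mul (e : Δ.Edge) :
    (edgeUnit p e : LocalizedJacobiAlgebra Δ.potential) * jacobiUnits p (head e) (tail e) =
      pathMk Δ (posArrow e).toPath := by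
  refine ((isMatrixUnits_jacobiUnits p).sum_mul _ _ _ _ _).trans ?_
  rw [jacobiUnits_self, jacobiUnits_self, pathMk_mul, pathMk_mul, Quiver.Path.nil_comp,
    Quiver.Path.comp_nil]

theorem edgeUnit_inv_mul (e : Δ.Edge) :
    ((edgeUnit p e)⁻¹ : (LocalizedJacobiAlgebra Δ.potential)ˣ) *
      jacobiUnits p (tail e) (head e) = pathMk Δ (negArrow e).toPath := by
  refine ((isMatrixUnits_jacobiUnits p).sum_mul _ _ _ _ _).trans ?_
  rw [jacobiUnits_self, jacobiUnits_self, pathMk_mul, pathMk_mul, Quiver.Path.nil_comp,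
    Quiver.Path.comp_nil]

/-- This separates the group part of a path from its endpoints. An arrow is its edge unit times a
matrix unit, and the units commute with the matrix units, so they can be collected on the left. -/
theorem pathMk_eq {i j : Quiver.Symmetrify Δ.Tile} (q : Quiver.Path i j) :
    pathMk Δ q = (holonomy (edgeUnit p) q : (LocalizedJacobiAlgebra Δ.potential)ˣ) *
      jacobiUnits p j i := by
  have hE := isMatrixUnits_jacobiUnits p
  induction q with
  | nil => rw [holonomy_nil, Units.val_one, one_mul, jacobiUnits_self]
  | cons q a ih =>
    have hq := commute_holonomy (commute_edgeUnit p) q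
    rw [← Quiver.Path.comp_toPath_eq_cons, ← pathMk_mul, ih, holonomy_comp, Units.val_mul]
    rcases a with ⟨a, rfl, rfl⟩ | ⟨a, rfl, rfl⟩
    · change pathMk Δ (posArrow a).toPath * (_ * jacobiUnits p (tail a) i) =
        (holonomy (edgeUnit p) (posArrow a).toPath : (LocalizedJacobiAlgebra Δ.potential)ˣ) * _ *
          jacobiUnits p (head a) i
      rw [holonomy_posArrow, ← edgeUnit_mul p, mul_assoc,
        ← mul_assoc (jacobiUnits p (head a) (tail a)),
        ← (hq _ _).eq, mul_assoc, hE.mul_eq, mul_assoc]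
    · change pathMk Δ (negArrow a).toPath * (_ * jacobiUnits p (head a) i) =
        (holonomy (edgeUnit p) (negArrow a).toPath : (LocalizedJacobiAlgebra Δ.potential)ˣ) * _ *
          jacobiUnits p (tail a) i
      rw [holonomy_negArrow, ← edgeUnit_inv_mul p, mul_assoc,
        ← mul_assoc (jacobiUnits p (tail a) (head a)),
        ← (hq _ _).eq, mul_assoc, hE.mul_eq, mul_assoc]

variable {p}

/-- As `p i₀` is trivial, `p i` is itself a matrix unit; comparison with `pathMk_eq` leaves holonomy
one. -/
theorem holonomy_edgeUnit (hp : p i₀ = Quiver.Path.nil) (i : Quiver.Symmetrify Δ.Tile) :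
    holonomy (edgeUnit p) (p i) = 1 := by
  have h := pathMk_eq p (p i)
  refine Units.ext ((isMatrixUnits_jacobiUnits p).eq_of_mul_eq
    (commute_holonomy (commute_edgeUnit p) (p i)) (fun _ _ => Commute.one_left _)
    (i := i) (j := i₀) ?_)
  rw [← h, Units.val_one, one_mul, jacobiUnits, hp, Quiver.Path.reverse, pathMk_mul,
    Quiver.Path.nil_comp]

/-- The Jacobi relation at `e` is the desired equality multiplied by the inverse unit of `e` and a
matrix unit. The latter cancels because everything else commutes with the matrix units. -/
theorem cycleProd_edgeUnit (e : Δ.Edge) :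
    cycleProd (edgeUnit p) Δ.σ e = cycleProd (edgeUnit p) Δ.τ.symm e := by
  have hE := isMatrixUnits_jacobiUnits p
  have h := eval_cyclicDerivative_potential Δ (U := edgeUnit p) (E := jacobiUnits p)
    (L := (RingQuot.mkAlgHom ℂ (JacobiRel Δ.potential)).toLinearMap.comp
      (PathAlgebra.toLocalized ℂ Δ.Tile))
    (fun q => by
      rw [LinearMap.comp_apply, PathAlgebra.toLocalized, PathAlgebra.path, PathAlgebra.lift_of,
        ← holonomy_mapPath]
      exact pathMk_eq p (Quiver.Symmetrify.of.mapPath q)) e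
  have h0 := (RingQuot.mkAlgHom_rel ℂ (JacobiRel.intro (W := Δ.potential) (dualArrow e))).trans
    (map_zero _)
  have h1 := sub_eq_zero.1 (h.symm.trans h0)
  have hc : ∀ (x : (LocalizedJacobiAlgebra Δ.potential)ˣ), (∃ ρ, x = cycleProd (edgeUnit p) ρ e *
      (edgeUnit p e)⁻¹) → ∀ i j, Commute (x : LocalizedJacobiAlgebra Δ.potential)
        (jacobiUnits p i j) := by
    rintro _ ⟨ρ, rfl⟩ i j
    have hw : ∀ n, Commute ((walkProd (edgeUnit p) ρ e n : (LocalizedJacobiAlgebra Δ.potential)ˣ) :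
      LocalizedJacobiAlgebra Δ.potential)
        (jacobiUnits p i j) := fun n => by
      induction n with
      | zero => exact Commute.one_left _
      | succ n ih => exact (commute_edgeUnit p _ i j).mul_left ih
    exact (hw _).mul_left (commute_edgeUnit p e i j).units_inv_left
  exact mul_right_cancel (Units.ext (hE.eq_of_mul_eq (hc _ ⟨_, rfl⟩) (hc _ ⟨_, rfl⟩) h1))

/-! ### The localized Jacobi algebra as a matrix algebra -/

theorem isMatrixUnits_single {ι R : Type*} [Fintype ι] [DecidableEq ι] [Ring R] :
    IsMatrixUnits fun i j : ι => (Matrix.single i j 1 : Matrix ι ι R) where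
  mul_eq i j l := by simp
  mul_of_ne i j k l h := by simp [h]
  sum_eq := Matrix.sum_single_one

theorem scalar_mul_single {ι R : Type*} [Fintype ι] [DecidableEq ι] [Ring R] (r : R) (i j : ι) :
    Matrix.scalar ι r * Matrix.single i j 1 = Matrix.single i j r := by
  ext k l
  simp [Matrix.scalar_apply, Matrix.diagonal_mul, Matrix.single_apply]

theorem commute_scalar_single {ι R : Type*} [Fintype ι] [DecidableEq ι] [Ring R] (r : R)
    (i j : ι) : Commute (Matrix.scalar ι r) (Matrix.single i j 1) := by
  refine (scalar_mul_single r i j).trans ?_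
  ext k l
  simp [Matrix.scalar_apply, Matrix.mul_diagonal, Matrix.single_apply]

/-- The map `F` sends a path to an elementary matrix carrying its holonomy. In the other direction,
`θ` sends a group element to the corresponding product of edge units, and `F ∘ θ` is the embedding
of scalar matrices. -/
theorem nonempty_algEquiv [DecidableEq (Quiver.Symmetrify Δ.Tile)]
    (hp : p i₀ = Quiver.Path.nil) :
    Nonempty (LocalizedJacobiAlgebra Δ.potential ≃ₐ[ℂ]
      Matrix (Quiver.Symmetrify Δ.Tile) (Quiver.Symmetrify Δ.Tile)
        (MonoidAlgebra ℂ (VertexGroup p))) := by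
  let J := LocalizedJacobiAlgebra Δ.potential
  let R := MonoidAlgebra ℂ (VertexGroup p)
  let M := Matrix (Quiver.Symmetrify Δ.Tile) (Quiver.Symmetrify Δ.Tile) R
  have hE := isMatrixUnits_jacobiUnits p
  let sc : R →ₐ[ℂ] M := Matrix.scalarAlgHom (Quiver.Symmetrify Δ.Tile) ℂ
  let S : VertexGroup p →* Mˣ :=
    ((sc : R →* M).comp (MonoidAlgebra.of ℂ (VertexGroup p))).toHomUnits
  let F : J →ₐ[ℂ] M := jacobiHom (U := fun e => S (PresentedGroup.of e)) isMatrixUnits_single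
    (fun e i j => commute_scalar_single _ i j)
    (fun e => by
      rw [← map_cycleProd, ← map_cycleProd, VertexGroup.cycleProd_eq])
  have hF : ∀ {i j : Quiver.Symmetrify Δ.Tile} (q : Quiver.Path i j),
      F (pathMk Δ q) = Matrix.single j i (MonoidAlgebra.of ℂ _ (holonomy PresentedGroup.of q)) :=
    fun q => by
      refine (jacobiHom_path _ _ _ q).trans ?_
      rw [← map_holonomy]
      exact scalar_mul_single _ _ _
  let θ : R →ₐ[ℂ] J := MonoidAlgebra.lift ℂ J (VertexGroup p) ((Units.coeHom J).comp
    (VertexGroup.lift (edgeUnit p) cycleProd_edgeUnit (holonomy_edgeUnit hp)))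
  have hθ : ∀ {i j : Quiver.Symmetrify Δ.Tile} (q : Quiver.Path i j),
      θ (MonoidAlgebra.of ℂ _ (holonomy PresentedGroup.of q)) = (holonomy (edgeUnit p) q : Jˣ) :=
    fun q => by
      rw [MonoidAlgebra.lift_of, MonoidHom.comp_apply, map_holonomy]
      simp only [VertexGroup.lift_of]
      rfl
  have hFE : ∀ i j, F (jacobiUnits p i j) = Matrix.single i j 1 := fun i j => by
    rw [jacobiUnits, pathMk_mul, hF, holonomy_comp, holonomy_reverse, VertexGroup.holonomy_eq,
      VertexGroup.holonomy_eq, inv_one, mul_one, map_one]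
  -- Both sides commute with the matrix units, so it is enough to compare them on one matrix unit,
  -- where `edgeUnit_mul` yields the arrow itself.
  have hFU : ∀ e, F (edgeUnit p e) = S (PresentedGroup.of e) := fun e => by
    refine isMatrixUnits_single.eq_of_mul_eq (fun i j => ?_)
      (fun i j => commute_scalar_single _ i j) (i := head e) (j := tail e) ?_
    · rw [← hFE]
      exact (commute_edgeUnit p e i j).map F
    · rw [← hFE, ← map_mul, edgeUnit_mul, hF, holonomy_posArrow, hFE]
      exact (scalar_mul_single _ _ _).symm
  have hFθ : ∀ r, F (θ r) = sc r := fun r => by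
    have h1 : (Units.map (F : J →* M)).comp (VertexGroup.lift (edgeUnit p) cycleProd_edgeUnit
        (holonomy_edgeUnit hp)) = S := PresentedGroup.ext fun e => Units.ext <| by
      rw [MonoidHom.comp_apply, VertexGroup.lift_of]
      exact hFU e
    have h2 : F.comp θ = sc := MonoidAlgebra.algHom_ext' (MonoidHom.ext fun g => by
      refine Eq.trans ?_ (congrArg Units.val (DFunLike.congr_fun h1 g))
      change F (θ (MonoidAlgebra.of ℂ _ g)) = _
      rw [MonoidAlgebra.lift_of]
      rfl) (Subsingleton.elim _ _)
    exact DFunLike.congr_fun h2 r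
  -- Linearity is enough for the inverse, since `F` is already an algebra homomorphism.
  let B : M →ₗ[ℂ] J := ∑ i, ∑ j, (LinearMap.mulRight ℂ (jacobiUnits p i j)).comp
    (θ.toLinearMap.comp (Matrix.entryLinearMap ℂ R i j))
  have hB : ∀ m, B m = ∑ i, ∑ j, θ (m i j) * jacobiUnits p i j := fun m => by
    simp [B]
    rfl
  refine ⟨AlgEquiv.ofBijective F ⟨Function.LeftInverse.injective (g := B) ?_,
    Function.RightInverse.surjective (g := B) ?_⟩⟩
  -- Classes of paths span the Jacobi algebra, and on them the identity is `pathMk_eq`.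
  · have h1 : (B.comp F.toLinearMap).comp (jacobiMk Δ).toLinearMap = (jacobiMk Δ).toLinearMap := by
      refine PathAlgebra.hom_ext ℂ fun ⟨i, j, q⟩ => ?_
      change B (F (pathMk Δ q)) = pathMk Δ q
      rw [hF, hB, Finset.sum_eq_single j, Finset.sum_eq_single i]
      · rw [Matrix.single_apply_same, hθ, ← pathMk_eq]
      · intro k _ hk
        rw [Matrix.single_apply_of_ne _ _ _ _ _ (fun h => hk h.2.symm), map_zero, zero_mul]
      · simp
      · intro k _ hk
        refine Finset.sum_eq_zero fun l _ => ?_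
        rw [Matrix.single_apply_of_ne _ _ _ _ _ (fun h => hk h.1.symm), map_zero, zero_mul]
      · simp
    intro x
    obtain ⟨x, rfl⟩ := RingQuot.mkAlgHom_surjective ℂ _ x
    obtain ⟨x, rfl⟩ := RingQuot.mkAlgHom_surjective ℂ _ x
    exact LinearMap.congr_fun h1 x
  · intro m
    rw [hB, map_sum]
    refine Eq.trans ?_ (Matrix.matrix_eq_sum_single m).symm
    refine Finset.sum_congr rfl fun i _ => ?_
    rw [map_sum]
    refine Finset.sum_congr rfl fun j _ => ?_
    rw [map_mul, hFθ, hFE]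
    exact scalar_mul_single _ _ _

end Units

end BipartiteRotationSystem

/-! ### Fundamental groups of products and of the circle -/

/-- The fundamental group of a product is the product of the fundamental groups. -/
def fundamentalGroupProd {X Y : Type*} [TopologicalSpace X] [TopologicalSpace Y] (z : X × Y) :
    FundamentalGroup (X × Y) z ≃* FundamentalGroup X z.1 × FundamentalGroup Y z.2 where
  toFun γ := (Path.Homotopic.projLeft γ, Path.Homotopic.projRight γ)
  invFun γ := Path.Homotopic.prod γ.1 γ.2
  left_inv γ := Path.Homotopic.prod_projLeft_projRight (a₁ := z.1) (b₁ := z.2) γ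
  right_inv γ := Prod.ext (Path.Homotopic.projLeft_prod γ.1 γ.2)
    (Path.Homotopic.projRight_prod γ.1 γ.2)
  map_mul' γ γ' := Prod.ext ((FundamentalGroup.map ⟨_, continuous_fst⟩ z).map_mul γ γ')
    ((FundamentalGroup.map ⟨_, continuous_snd⟩ z).map_mul γ γ')

/-- A homeomorphism induces isomorphisms of fundamental groups. -/
def Homeomorph.fundamentalGroupEquiv {X Y : Type} [TopologicalSpace X] [TopologicalSpace Y]
    (f : X ≃ₜ Y) (x : X) : FundamentalGroup X x ≃* FundamentalGroup Y (f x) :=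
  (FundamentalGroupoidFunctor.equivOfHomotopyEquiv
    f.toHomotopyEquiv).fullyFaithfulFunctor.mulEquivEnd (FundamentalGroupoid.mk x)

theorem nonempty_fundamentalGroup_circle (x : Circle) :
    Nonempty (FundamentalGroup Circle x ≃* Multiplicative ℤ) := by
  let f : AddCircle (1 : ℝ) ≃ₜ Circle := AddCircle.homeomorphCircle one_ne_zero
  obtain ⟨y, rfl⟩ := f.surjective x
  obtain ⟨t, rfl⟩ := QuotientAddGroup.mk_surjective y
  have e := (AddCircle.isAddQuotientCoveringMap_coe (1 : ℝ)).fundamentalGroupEquiv ⟨t, rfl⟩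
  have hinj : Function.Injective (zmultiplesHom ℝ 1) := fun m n h => by
    simpa [zmultiplesHom_apply] using h
  let z : ℤ ≃+ AddSubgroup.zmultiples (1 : ℝ) := (AddMonoidHom.ofInjective hinj).trans
    (AddEquiv.addSubgroupCongr (AddSubgroup.range_zmultiplesHom 1))
  exact ⟨(f.fundamentalGroupEquiv _).symm.trans ((e.trans
    -- The covering by the real line gives the opposite of the group of translations; inversion
    -- removes the opposite.
    (MulEquiv.inv' (Multiplicative (AddSubgroup.zmultiples (1 : ℝ)))).symm).trans
      z.toMultiplicative.symm)⟩

/-! ### Assembly for a closed surface -/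

instance (g : ℕ) : PathConnectedSpace (ClosedSurface g) := by
  have : PathConnectedSpace (Metric.closedBall (0 : ℂ) 1) :=
    isPathConnected_iff_pathConnectedSpace.1
      ((convex_closedBall _ _).isPathConnected (Metric.nonempty_closedBall.2 zero_le_one))
  exact Quot.mk_surjective.pathConnectedSpace continuous_quot_mk

namespace BipartiteRotationSystem

variable {Δ : BipartiteRotationSystem} {i₀ : Quiver.Symmetrify Δ.Tile}
  {p : ∀ i : Quiver.Symmetrify Δ.Tile, Quiver.Path i₀ i}

/-- The surface group of a brane tiling is the fundamental group of the surface. -/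
def surfaceGroupEquiv (hp : p i₀ = Quiver.Path.nil) :
    SurfaceGroup p ≃* FundamentalGroup Δ.Realization (center i₀) :=
  MulEquiv.ofBijective (loopHom hp) ⟨loopHom_injective hp, loopHom_surjective hp⟩

end BipartiteRotationSystem

/-- The central factor `ℤ` matches the circle. The surface factor is carried over by the
homeomorphism from the realization, and path-connectedness moves the base point from a tile centre
to the given point. -/
theorem BraneTiling.nonempty_vertexGroup_mulEquiv {S : Type} [TopologicalSpace S]
    [PathConnectedSpace S] (Δ : BraneTiling S) (hΔ : Δ.IsGraded)
    (hc : Δ.IsTransitive) {i₀ : Quiver.Symmetrify Δ.Tile}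
    {p : ∀ i : Quiver.Symmetrify Δ.Tile, Quiver.Path i₀ i} (hp : p i₀ = Quiver.Path.nil)
    (x : S × Circle) :
    Nonempty (BipartiteRotationSystem.VertexGroup p ≃* FundamentalGroup (S × Circle) x) := by
  obtain ⟨e₀, -⟩ := Quotient.exists_rep (s := Equiv.Perm.SameCycle.setoid (Δ.τ * Δ.σ)) i₀
  obtain ⟨f⟩ := hΔ.nonempty_mulEquiv hc hp e₀
  obtain ⟨c⟩ := nonempty_fundamentalGroup_circle x.2
  let s := ((BipartiteRotationSystem.surfaceGroupEquiv hp).trans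
    (Δ.homeo.fundamentalGroupEquiv _)).trans
      (FundamentalGroup.fundamentalGroupMulEquivOfPathConnected _ x.1)
  exact ⟨f.trans ((s.prodCongr c.symm).trans (fundamentalGroupProd x).symm)⟩

end

theorem mainTheorem2 (g : ℕ) (hg : 1 ≤ g) (Δ : BraneTiling (ClosedSurface g))
    (hΔ : Δ.IsGraded) (x : ClosedSurface g × Circle) :
    Nonempty (LocalizedJacobiAlgebra Δ.potential ≃ₐ[ℂ]
      Matrix (Fin (Fintype.card Δ.Tile)) (Fin (Fintype.card Δ.Tile))
        (MonoidAlgebra ℂ (FundamentalGroup (ClosedSurface g × Circle) x))) := by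
  classical
  have : ConnectedSpace Δ.Realization := Δ.homeo.symm.surjective.connectedSpace
    Δ.homeo.symm.continuous
  have hc := BipartiteRotationSystem.isTransitive_of_connectedSpace
    (Δ := Δ.toBipartiteRotationSystem)
  -- Any point of the surface lies in the square of some edge, whose left tile serves as base tile.
  obtain ⟨⟨e, -⟩, -⟩ := Quot.exists_rep (Δ.homeo.symm x.1)
  obtain ⟨p, hp⟩ := hc.exists_paths (BipartiteRotationSystem.leftTile e)
  obtain ⟨a⟩ := BipartiteRotationSystem.nonempty_algEquiv hp
  obtain ⟨b⟩ := Δ.nonempty_vertexGroup_mulEquiv hΔ hc hp x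
  exact ⟨a.trans ((MonoidAlgebra.domCongr ℂ ℂ b).mapMatrix.trans
    (Matrix.reindexAlgEquiv ℂ _ (Fintype.equivFin Δ.Tile)))⟩
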